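/- **Terms and equations.** A second-order signature $\Sigma$ is a set of operators, each with an arity $(n_1,\dots,n_l)\in\mathbb N^*$. Terms $\Theta\triangleright\Gamma\vdash t$, with $\Theta=(\mathsf m_1{:}[m_1],\dots,\mathsf m_k{:}[m_k])$ and $\Gamma=(x_1,\dots,x_n)$, are taken up to $\alpha$-equivalence and generated by: variables $x\in\Gamma$; $\mathsf m_i[t_1,\dots,t_{m_i}]$ for terms $\Theta\triangleright\Gamma\vdash t_j$; and $\omega((\vec y_1)t_1,\dots,(\vec y_l)t_l)$ for $\omega:(n_1,\dots,n_l)$ and $\Theta\triangleright\Gamma,\vec y_i\vdash t_i$ with $|\vec y_i|=n_i$. Metasubstitution $t\{\mathsf m_i:=(\vec y_i)s_i\}_i$ replaces each $\mathsf m_i[t_1,\dots,t_{m_i}]$ by $s_i$ with the $t_j$ (after metasubstitution) substituted, without capture, for $\vec y_i$. A second-order equational presentation $\mathcal E=(\Sigma,E)$ is a signature with a set $E$ of axioms $\Theta\triangleright\Gamma\vdash s\equiv t$. Derivability in $\mathcal E$ is generated by the axioms, reflexivity, symmetry, transitivity, and the rule: from $\mathsf m_1{:}[m_1],\dots,\mathsf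 m_k{:}[m_k]\triangleright\Gamma\vdash s\equiv t$ and $\Theta\triangleright\Delta,\vec y_i\vdash s_i\equiv t_i$ $(1\le i\le k)$ infer $\Theta\triangleright\Gamma,\Delta\vdash s\{\mathsf m_i:=(\vec y_i)s_i\}_i\equiv t\{\mathsf m_i:=(\vec y_i)t_i\}_i$. **Classifying theory.** The category $\mathbb M(\mathcal E)$ has objects $\mathbb N^*$; a morphism $(m_1,\dots,m_k)\to(n_1,\dots,n_l)$ is a tuple of derivable-equality classes $\langle[\mathsf m_1{:}[m_1],\dots,\mathsf m_k{:}[m_k]\triangleright x_1,\dots,x_{n_i}\vdash t_i]_{\mathcal E}\rangle_{1\le i\le l}$; the identity is $\langle[\mathsf m_i[x_1,\dots,x_{m_i}]]_{\mathcal E}\rangle_i$ and composition is metasubstitution. Let $\mathbb M$ be $\mathbb M(\mathcal E_0)$ for the presentation $\mathcal E_0$ without operators and axioms, and let $M_{\mathcal E}:\mathbb M\to\mathbb M(\mathcal E)$ be the canonical identity-on-objects functor. For a category $\mathcal C$ with finite products, $\mathbf{FMod}(M_{\mathcal E},\mathcal C)$ is the category of functors $\mathbb M(\mathcal E)\to\mathcal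 C$ preserving finite products up to (canonical) isomorphism, and (necessarily monoidal) natural transformations. **Clones.** A $\Sigma$-clone in $\mathcal C$ consists of objects $(S_n)_{n\in\mathbb N}$ and morphisms $\iota^{(n)}_i:1\to S_n$ $(1\le i\le n)$, $\varsigma_{m,n}:S_m\times S_n^m\to S_n$, and $\tilde\omega_n:\prod_iS_{n+n_i}\to S_n$ for each operator $\omega:(n_1,\dots,n_l)$ and each $n$, such that (writing composites on generalized elements) - $\varsigma_{n,n}(t;\iota^{(n)}_1,\dots,\iota^{(n)}_n)=t$ and $\varsigma_{m,n}(\iota^{(m)}_i;\vec u)=u_i$; - $\varsigma_{m,n}(\varsigma_{l,m}(t;\vec u);\vec v)=\varsigma_{l,n}(t;\varsigma_{m,n}(u_1;\vec v),\dots,\varsigma_{m,n}(u_l;\vec v))$; - each $\tilde\omega_n$ is natural in $n$ for the action $S_f(t)=\varsigma_{m,n}(t;\iota^{(n)}_{f(1)},\dots,\iota^{(n)}_{f(m)})$ of maps $f:\{1,\dots,m\}\to\{1,\dots,n\}$, where $S_{m+n_i}\to S_{n+n_i}$ is the action of the map that is $f$ on the first $m$ elements and fixes the last $n_i$; - $\varsigma_{n,m}(\tilde\omega_n(t_1,\dots,t_l);\vec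 u)=\tilde\omega_m\big(\varsigma_{n+n_i,m+n_i}(t_i;S_j(u_1),\dots,S_j(u_n),\iota^{(m+n_i)}_{m+1},\dots,\iota^{(m+n_i)}_{m+n_i})\big)_{1\le i\le l}$, with $j$ the inclusion $\{1,\dots,m\}\subseteq\{1,\dots,m+n_i\}$. Homomorphisms are families $h_n:S_n\to S'_n$ commuting with all $\iota^{(n)}_i$, $\varsigma_{m,n}$ and $\tilde\omega_n$. A term $\Theta\triangleright x_1,\dots,x_n\vdash t$ is interpreted as $[\![t]\!]_S:\prod_iS_{m_i}\to S_n$ by $[\![x_i]\!]=\iota^{(n)}_i\circ{!}$, $[\![\mathsf m_i[t_1,\dots,t_{m_i}]]\!]=\varsigma_{m_i,n}\circ\langle\pi_i,[\![t_1]\!],\dots,[\![t_{m_i}]\!]\rangle$, and $[\![\omega((\vec y_1)t_1,\dots,(\vec y_l)t_l)]\!]=\tilde\omega_n\circ\langle[\![t_i]\!]\rangle_i$. The extension of $t$ by $d\ge 0$ variables is the term $$\mathsf m_1{:}[m_1+d],\dots,\mathsf m_k{:}[m_k+d]\triangleright\Gamma,z_1,\dots,z_d\vdash t^{\#d}=t\{\mathsf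 m_i:=(y_1,\dots,y_{m_i})\,\mathsf m_i[y_1,\dots,y_{m_i},z_1,\dots,z_d]\}_i,$$ so that $t^{\#0}=t$. An $\mathcal E$-clone in $\mathcal C$ is a $\Sigma$-clone $S$ in $\mathcal C$ which satisfies the axioms of $\mathcal E$ in every extended variable context: $[\![s^{\#d}]\!]_S=[\![t^{\#d}]\!]_S$ for every axiom $\Theta\triangleright\Gamma\vdash s\equiv t$ and every $d\ge0$. $\mathcal E\text{-}\mathbf{Clone}(\mathcal C)$ is the full subcategory of the category of $\Sigma$-clones on the $\mathcal E$-clones. **Proposition 7.5.** For every second-order equational presentation $\mathcal E$ and every category $\mathcal C$ with finite products, the categories $\mathcal E\text{-}\mathbf{Clone}(\mathcal C)$ and $\mathbf{FMod}(M_{\mathcal E},\mathcal C)$ are equivalent. -/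

import Mathlib

open CategoryTheory CategoryTheory.Limits

universe u v w v' w'

namespace SecondOrder

/-! ### Second-order signatures and terms -/

/-- A finite sequence `(m₁, …, m_k)` of natural numbers, i.e. an element of `ℕ*`.
It serves as an operator arity, as a metavariable context `𝗆₁ : [m₁], …, 𝗆_k : [m_k]`, and as an
object of the classifying categories. -/
structure NatSeq where
  /-- The length `k` of the sequence. -/
  len : ℕ
  /-- The entries `m₁, …, m_k`. -/
  entry : Fin len → ℕ

/-- A (mono-sorted) second-order signature: a set of operators with arities in `ℕ*`. An operator
of arity `(n₁, …, n_l)` takes `l` arguments and binds `n_i` variables in the `i`-th one. -/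
structure Signature : Type (u + 1) where
  /-- The operators. -/
  Op : Type u
  /-- The arity function. -/
  arity : Op → NatSeq

/-- The terms `Θ ▹ x₁, …, x_n ⊢ t`, up to `α`-equivalence: in context the variables are
`x₁, …, x_n`, represented by `Fin n`, and the variables bound by an operator are appended at the
end of the context. -/
inductive Term (S : Signature.{u}) (Θ : NatSeq) : ℕ → Type u
  | var {n : ℕ} (x : Fin n) : Term S Θ n
  | mvar {n : ℕ} (i : Fin Θ.len) (ts : Fin (Θ.entry i) → Term S Θ n) : Term S Θ n
  | op {n : ℕ} (ω : S.Op)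
      (ts : ∀ i : Fin (S.arity ω).len, Term S Θ (n + (S.arity ω).entry i)) : Term S Θ n

/-- The map `f + k` that acts as `f` on the first variables and fixes the last `k` ones. -/
def up {n m : ℕ} (f : Fin n → Fin m) (k : ℕ) : Fin (n + k) → Fin (m + k) :=
  Fin.append (fun x => Fin.castAdd k (f x)) (Fin.natAdd m)

namespace Term

variable {S : Signature.{u}} {Θ Θ' Θ'' : NatSeq}

/-- Renaming of variables. -/
def ren : {n m : ℕ} → (Fin n → Fin m) → Term S Θ n → Term S Θ m
  | _, _, f, var x => var (f x)
  | _, _, f, mvar i ts => mvar i (fun j => (ts j).ren f)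
  | _, _, f, op ω ts => op ω (fun i => (ts i).ren (up f _))

/-- Extension of a substitution `x_i := t_i` by `y_j := z_j` for `k` fresh variables `z_j`. -/
def lift {n m : ℕ} (σ : Fin n → Term S Θ m) (k : ℕ) : Fin (n + k) → Term S Θ (m + k) :=
  Fin.append (fun x => (σ x).ren (Fin.castAdd k)) (fun z => var (Fin.natAdd m z))

/-- Capture-avoiding simultaneous substitution `t {x_i := σ_i}`. -/
def subst : {n m : ℕ} → (Fin n → Term S Θ m) → Term S Θ n → Term S Θ m
  | _, _, σ, var x => σ x
  | _, _, σ, mvar i ts => mvar i (fun j => (ts j).subst σ)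
  | _, _, σ, op ω ts => op ω (fun i => (ts i).subst (lift σ _))

/-- Metasubstitution `t {𝗆_i := (x⃗_i) s_i}`, for `Θ ▹ Γ ⊢ t` and `Θ' ▹ Γ, x⃗_i ⊢ s_i`. -/
def msub : {n : ℕ} → (∀ i : Fin Θ.len, Term S Θ' (n + Θ.entry i)) → Term S Θ n → Term S Θ' n
  | _, _, var x => var x
  | _, s, mvar l ts => (s l).subst (Fin.append var (fun j => (ts j).msub s))
  | _, s, op ω ts => op ω (fun i =>
      (ts i).msub (fun p => (s p).ren (up (Fin.castAdd ((S.arity ω).entry i)) (Θ.entry p))))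

/-- Metasubstitution in extended context: for `Θ ▹ Γ ⊢ t` and `Θ' ▹ Δ, x⃗_i ⊢ s_i`, the term
`Θ' ▹ Γ, Δ ⊢ t {𝗆_i := (x⃗_i) s_i}`, where `Γ` has `n` and `Δ` has `d` variables. -/
def extMsub {n d : ℕ} (s : ∀ i : Fin Θ.len, Term S Θ' (d + Θ.entry i)) (t : Term S Θ n) :
    Term S Θ' (n + d) :=
  (t.ren (Fin.castAdd d)).msub (fun i => (s i).ren (up (Fin.natAdd n) (Θ.entry i)))

/-- The term `𝗆_i[x₁, …, x_{m_i}]` in variable context `x₁, …, x_{m_i}`. -/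
def generic (i : Fin Θ.len) : Term S Θ (Θ.entry i) := mvar i var

end Term

/-- The metavariable context `𝗆₁ : [m₁ + d], …, 𝗆_k : [m_k + d]`. -/
def NatSeq.shift (Θ : NatSeq) (d : ℕ) : NatSeq := ⟨Θ.len, fun i => Θ.entry i + d⟩

/-- The term `𝗆_i[y₁, …, y_{m_i}, x₁, …, x_d]` with `𝗆_i : [m_i + d]`, in variable context
`x₁, …, x_d, y₁, …, y_{m_i}`. -/
def Term.shiftGeneric (S : Signature.{u}) (Θ : NatSeq) (d : ℕ) (i : Fin Θ.len) :
    Term S (Θ.shift d) (d + Θ.entry i) :=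
  let args : Fin (Θ.entry i + d) → Term S (Θ.shift d) (d + Θ.entry i) :=
    Fin.append (fun y => .var (Fin.natAdd d y)) (fun x => .var (Fin.castAdd (Θ.entry i) x))
  .mvar (Θ := Θ.shift d) i args

/-- The extension `t^#` of a term by `d` variables: for `Θ ▹ Γ ⊢ t` this is
`𝗆₁ : [m₁ + d], …, 𝗆_k : [m_k + d] ▹ Γ, x₁, …, x_d ⊢
  t {𝗆_i := (y₁, …, y_{m_i}) 𝗆_i[y₁, …, y_{m_i}, x₁, …, x_d]}`. -/
def Term.extend {S : Signature.{u}} {Θ : NatSeq} {n : ℕ} (d : ℕ) (t : Term S Θ n) :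
    Term S (Θ.shift d) (n + d) :=
  t.extMsub (Term.shiftGeneric S Θ d)

/-! ### Second-order equational presentations and equational logic -/

/-- A second-order equation `Θ ▹ x₁, …, x_n ⊢ lhs ≡ rhs`. -/
structure Equation (S : Signature.{u}) : Type u where
  /-- The metavariable context. -/
  mctx : NatSeq
  /-- The number of variables. -/
  ctx : ℕ
  /-- The left-hand side. -/
  lhs : Term S mctx ctx
  /-- The right-hand side. -/
  rhs : Term S mctx ctx

/-- A second-order equational presentation `E = (Σ, E)`. -/
structure Presentation : Type (u + 1) where
  /-- The signature. -/
  sig : Signature.{u}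
  /-- The axioms. -/
  axs : Set (Equation sig)

/-- Second-order equational logic: provable equality `Θ ▹ Γ ⊢ s ≡ t` from the axioms of `E`. -/
inductive Derivable (E : Presentation.{u}) :
    {Θ : NatSeq} → {n : ℕ} → Term E.sig Θ n → Term E.sig Θ n → Prop
  | ax (e : Equation E.sig) (he : e ∈ E.axs) : Derivable E e.lhs e.rhs
  | refl {Θ : NatSeq} {n : ℕ} (t : Term E.sig Θ n) : Derivable E t t
  | symm {Θ : NatSeq} {n : ℕ} {s t : Term E.sig Θ n} : Derivable E s t → Derivable E t s
  | trans {Θ : NatSeq} {n : ℕ} {s t r : Term E.sig Θ n} :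
      Derivable E s t → Derivable E t r → Derivable E s r
  | extMsub {Θ Θ' : NatSeq} {n d : ℕ} {s t : Term E.sig Θ n}
      {a b : ∀ i : Fin Θ.len, Term E.sig Θ' (d + Θ.entry i)} :
      Derivable E s t → (∀ i, Derivable E (a i) (b i)) →
      Derivable E (s.extMsub a) (t.extMsub b)

/-! ### The substitution calculus -/

@[simp] theorem up_castAdd {n m : ℕ} (f : Fin n → Fin m) (k : ℕ) (x : Fin n) :
    up f k (Fin.castAdd k x) = Fin.castAdd k (f x) := by
  simp [up]

@[simp] theorem up_natAdd {n m : ℕ} (f : Fin n → Fin m) (k : ℕ) (x : Fin k) :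
    up f k (Fin.natAdd n x) = Fin.natAdd m x := by
  simp [up]

theorem up_up {n m l : ℕ} (f : Fin n → Fin m) (g : Fin m → Fin l) (k : ℕ) (x : Fin (n + k)) :
    up g k (up f k x) = up (fun y => g (f y)) k x := by
  induction x using Fin.addCases <;> simp

theorem up_id (n k : ℕ) : up (fun x : Fin n => x) k = fun x => x := by
  funext x
  induction x using Fin.addCases <;> simp

namespace Term

variable {S : Signature.{u}} {Θ Θ' Θ'' : NatSeq}

@[simp] theorem lift_castAdd {n m : ℕ} (σ : Fin n → Term S Θ m) (k : ℕ) (x : Fin n) :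
    lift σ k (Fin.castAdd k x) = (σ x).ren (Fin.castAdd k) := by
  simp [lift]

@[simp] theorem lift_natAdd {n m : ℕ} (σ : Fin n → Term S Θ m) (k : ℕ) (x : Fin k) :
    lift σ k (Fin.natAdd n x) = var (Fin.natAdd m x) := by
  simp [lift]

theorem ren_id {n : ℕ} (t : Term S Θ n) : t.ren (fun x => x) = t := by
  induction t with
  | var x => rfl
  | mvar i ts ih => simp [ren, ih]
  | op ω ts ih => simp [ren, up_id, ih]

theorem ren_ren {n : ℕ} (t : Term S Θ n) {m l : ℕ} (f : Fin n → Fin m) (g : Fin m → Fin l) :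
    (t.ren f).ren g = t.ren (fun x => g (f x)) := by
  induction t generalizing m l with
  | var x => rfl
  | mvar i ts ih => simp [ren, ih]
  | op ω ts ih => simp [ren, ih, up_up]

theorem subst_ren {n : ℕ} (t : Term S Θ n) {m l : ℕ} (f : Fin n → Fin m)
    (σ : Fin m → Term S Θ l) : (t.ren f).subst σ = t.subst (fun x => σ (f x)) := by
  induction t generalizing m l with
  | var x => rfl
  | mvar i ts ih => simp [ren, subst, ih]
  | op ω ts ih =>
    simp only [ren, subst, ih]
    congr 1; funext i; congr 1; funext x
    induction x using Fin.addCases <;> simp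

theorem ren_subst {n : ℕ} (t : Term S Θ n) {m l : ℕ} (σ : Fin n → Term S Θ m)
    (f : Fin m → Fin l) : (t.subst σ).ren f = t.subst (fun x => (σ x).ren f) := by
  induction t generalizing m l with
  | var x => rfl
  | mvar i ts ih => simp [ren, subst, ih]
  | op ω ts ih =>
    simp only [ren, subst, ih]
    congr 1; funext i; congr 1; funext x
    induction x using Fin.addCases <;> simp [ren_ren, ren]

theorem subst_var {n : ℕ} (t : Term S Θ n) : t.subst var = t := by
  induction t with
  | var x => rfl
  | mvar i ts ih => simp [subst, ih]
  | @op n ω ts ih =>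
    have h : ∀ k, lift (S := S) (Θ := Θ) (n := n) var k = var := by
      intro k; funext x
      induction x using Fin.addCases <;> simp [ren]
    simp [subst, h, ih]

theorem subst_subst {n : ℕ} (t : Term S Θ n) {m l : ℕ} (σ : Fin n → Term S Θ m)
    (τ : Fin m → Term S Θ l) : (t.subst σ).subst τ = t.subst (fun x => (σ x).subst τ) := by
  induction t generalizing m l with
  | var x => rfl
  | mvar i ts ih => simp [subst, ih]
  | op ω ts ih =>
    simp only [subst, ih]
    congr 1; funext i; congr 1; funext x
    induction x using Fin.addCases <;> simp [subst_ren, ren_subst, subst]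

theorem ren_eq_subst {n m : ℕ} (t : Term S Θ n) (f : Fin n → Fin m) :
    t.ren f = t.subst (fun x => var (f x)) := by
  conv_lhs => rw [← subst_var (t.ren f), subst_ren]

theorem ren_msub {n : ℕ} (t : Term S Θ n) {m : ℕ} (f : Fin n → Fin m)
    (s : ∀ i : Fin Θ.len, Term S Θ' (n + Θ.entry i)) :
    (t.msub s).ren f = (t.ren f).msub (fun p => (s p).ren (up f _)) := by
  induction t generalizing m with
  | var x => rfl
  | mvar i ts ih =>
    simp only [ren, msub, ren_subst, subst_ren]
    congr 1; funext x
    induction x using Fin.addCases with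
    | left x => simp [ren]
    | right x => simpa using ih x f s
  | op ω ts ih =>
    simp only [ren, msub, ih, ren_ren, up_up]
    congr 1; funext i; congr 1; funext p; congr 2; funext x; simp

theorem subst_msub {n : ℕ} (t : Term S Θ n) {m : ℕ} (σ : Fin n → Term S Θ m)
    (s' : ∀ i : Fin Θ.len, Term S Θ' (n + Θ.entry i))
    (s : ∀ i : Fin Θ.len, Term S Θ' (m + Θ.entry i))
    (h : ∀ p, (s' p).subst (lift (fun x => (σ x).msub s) _) = s p) :
    (t.msub s').subst (fun x => (σ x).msub s) = (t.subst σ).msub s := by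
  induction t generalizing m with
  | var x => rfl
  | mvar i ts ih =>
    simp only [subst, msub]
    rw [← h i, subst_subst, subst_subst]
    congr 1; funext x
    induction x using Fin.addCases with
    | left x => simp [subst, subst_ren, subst_var]
    | right x => simpa [subst] using ih x σ s' s h
  | op ω ts ih =>
    simp only [subst, msub]
    congr 1; funext i
    rw [← ih i (lift σ _) _ _ ?_]
    · congr 1; funext x
      induction x using Fin.addCases <;> simp [ren_msub, msub]
    · intro p
      rw [← h p, subst_ren, ren_subst]
      congr 1; funext x
      induction x using Fin.addCases with
      | left x => simp [ren_ren, ren_msub, up_up]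
      | right x => simp [ren]

theorem msub_msub {n : ℕ} (t : Term S Θ n)
    (r : ∀ i : Fin Θ.len, Term S Θ' (n + Θ.entry i))
    (s : ∀ i : Fin Θ'.len, Term S Θ'' (n + Θ'.entry i)) :
    (t.msub r).msub s = t.msub (fun p => (r p).msub
      (fun q => (s q).ren (up (Fin.castAdd (Θ.entry p)) _))) := by
  induction t with
  | var x => rfl
  | mvar i ts ih =>
    simp only [msub]
    rw [← subst_msub (r i) _ (fun q => (s q).ren (up (Fin.castAdd _) _)) s]
    · congr 1; funext x
      induction x using Fin.addCases <;> simp [msub, ih]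
    · intro p
      rw [subst_ren]
      conv_rhs => rw [← subst_var (s p)]
      congr 1; funext x
      induction x using Fin.addCases <;> simp [msub, ren]
  | op ω ts ih =>
    simp only [msub, ih]
    congr 1; funext i; congr 1; funext p
    rw [ren_msub]
    congr 1; funext q
    simp only [ren_ren, up_up]
    congr 2; funext x; simp

/-- Composition of tuples of terms, one component at a time: `t {𝗆_p := (x⃗_p) s_p}`. -/
def cmp {n : ℕ} (s : ∀ p : Fin Θ.len, Term S Θ' (Θ.entry p)) (t : Term S Θ n) : Term S Θ' n :=
  t.msub (fun p => (s p).ren (Fin.natAdd n))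

theorem generic_cmp (s : ∀ p : Fin Θ.len, Term S Θ' (Θ.entry p)) (i : Fin Θ.len) :
    (generic i).cmp s = s i := by
  simp only [cmp, generic, msub, subst_ren]
  conv_rhs => rw [← subst_var (s i)]
  congr 1; funext x
  exact Fin.append_right _ _ _

theorem cmp_generic {n : ℕ} (t : Term S Θ n) : t.cmp generic = t := by
  unfold cmp
  induction t with
  | var x => rfl
  | mvar i ts ih =>
    simp only [generic, ren] at ih
    simp [msub, generic, ren, subst, ih]
  | op ω ts ih =>
    simp only [generic, ren] at ih
    simp [msub, generic, ren, ih]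

theorem cmp_cmp {n : ℕ} (t : Term S Θ n) (s : ∀ p : Fin Θ.len, Term S Θ' (Θ.entry p))
    (r : ∀ p : Fin Θ'.len, Term S Θ'' (Θ'.entry p)) :
    (t.cmp s).cmp r = t.cmp (fun p => (s p).cmp r) := by
  unfold cmp
  rw [msub_msub]
  congr 1; funext p
  rw [ren_msub]
  congr 1; funext q
  simp only [ren_ren]
  congr 1; funext x; simp

end Term

/-! ### The classifying category of a presentation -/

variable {E : Presentation.{u}} {Θ Θ' Θ'' : NatSeq}

theorem Derivable.cast {n m : ℕ} (h : n = m) {s t : Term E.sig Θ n} (d : Derivable E s t) :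
    Derivable E (s.ren (Fin.cast h)) (t.ren (Fin.cast h)) := by
  subst h
  have e : Fin.cast (rfl : n = n) = fun x => x := rfl
  rw [e, Term.ren_id, Term.ren_id]
  exact d

theorem Term.cmp_eq_extMsub {S : Signature.{u}} {n : ℕ}
    (a : ∀ p : Fin Θ.len, Term S Θ' (Θ.entry p)) (t : Term S Θ n) :
    t.cmp a = t.extMsub (d := 0) (fun p => (a p).ren (Fin.cast (Nat.zero_add _).symm)) := by
  unfold Term.cmp Term.extMsub
  have e : (Fin.castAdd 0 : Fin n → Fin (n + 0)) = fun x => x := rfl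
  rw [e, Term.ren_id]
  change _ = t.msub _
  congr 1; funext p
  rw [Term.ren_ren]
  congr 1; funext x
  have hx : Fin.cast (Nat.zero_add (Θ.entry p)).symm x = Fin.natAdd 0 x := by
    ext; simp
  rw [hx, up_natAdd]
  rfl

/-- The extension by no variables is the term itself. -/
theorem Term.extend_zero {S : Signature.{u}} {n : ℕ} (t : Term S Θ n) : t.extend 0 = t := by
  have h : t.extend 0 = t.cmp Term.generic := by
    rw [Term.cmp_eq_extMsub]
    unfold Term.extend
    congr 1
    funext i
    change Term.mvar (Θ := Θ) i _ = Term.mvar (Θ := Θ) i _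
    congr 1
    funext j
    refine (Fin.append_left _ _ j).trans ?_
    congr 1; ext; simp
  exact h.trans (Term.cmp_generic t)

theorem Derivable.cmp {n : ℕ} {s t : Term E.sig Θ n}
    {a b : ∀ p : Fin Θ.len, Term E.sig Θ' (Θ.entry p)}
    (h : Derivable E s t) (hab : ∀ p, Derivable E (a p) (b p)) :
    Derivable E (s.cmp a) (t.cmp b) := by
  rw [Term.cmp_eq_extMsub, Term.cmp_eq_extMsub]
  exact Derivable.extMsub h (fun p => (hab p).cast _)

/-- Provable equality in `E` as an equivalence relation on the terms `Θ ▹ x₁, …, x_n ⊢ t`. -/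
def derivableSetoid (E : Presentation.{u}) (Θ : NatSeq) (n : ℕ) : Setoid (Term E.sig Θ n) where
  r := Derivable E
  iseqv := ⟨Derivable.refl, Derivable.symm, Derivable.trans⟩

/-- Equivalence classes `[Θ ▹ x₁, …, x_n ⊢ t]_E` of terms modulo provable equality in `E`. -/
abbrev TermClass (E : Presentation.{u}) (Θ : NatSeq) (n : ℕ) : Type u :=
  Quotient (derivableSetoid E Θ n)

/-- The equivalence class of a term. -/
abbrev cls (E : Presentation.{u}) {Θ : NatSeq} {n : ℕ} (t : Term E.sig Θ n) : TermClass E Θ n :=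
  Quotient.mk (derivableSetoid E Θ n) t

/-- Composition with a tuple of equivalence classes, computed on representatives. -/
noncomputable def TermClass.cmp {n : ℕ} (a : ∀ p : Fin Θ.len, TermClass E Θ' (Θ.entry p))
    (t : TermClass E Θ n) : TermClass E Θ' n :=
  Quotient.map (sa := derivableSetoid E Θ n) (sb := derivableSetoid E Θ' n)
    (fun t => t.cmp (fun p => (a p).out))
    (fun _ _ h => Derivable.cmp h (fun _ => Derivable.refl _)) t

/-- Composition may be computed on any representatives. -/
theorem TermClass.cmp_cls {n : ℕ} (a : ∀ p : Fin Θ.len, Term E.sig Θ' (Θ.entry p))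
    (t : Term E.sig Θ n) :
    TermClass.cmp (fun p => cls E (a p)) (cls E t) = cls E (t.cmp a) :=
  Quotient.sound (s := derivableSetoid E Θ' n)
    (Derivable.cmp (Derivable.refl t) (fun p => Quotient.mk_out (s := derivableSetoid E Θ' _) (a p)))

theorem exists_rep (a : ∀ p : Fin Θ.len, TermClass E Θ' (Θ.entry p)) :
    ∃ a' : ∀ p : Fin Θ.len, Term E.sig Θ' (Θ.entry p), a = fun p => cls E (a' p) :=
  ⟨fun p => (a p).out, funext fun p => (Quotient.out_eq (a p)).symm⟩

/-- The objects of the classifying category `𝕄(E)`: finite sequences of natural numbers. -/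
@[ext] structure Classifying (E : Presentation.{u}) where
  /-- The underlying sequence. -/
  seq : NatSeq

/-- The classifying category `𝕄(E)`: a morphism `(m₁, …, m_k) ⟶ (n₁, …, n_l)` is a tuple of
classes `[𝗆₁ : [m₁], …, 𝗆_k : [m_k] ▹ x₁, …, x_{n_i} ⊢ t_i]_E` for `1 ≤ i ≤ l`; identities are
`⟨𝗆_i[x₁, …, x_{m_i}]⟩_i` and composition is metasubstitution. -/
noncomputable instance (E : Presentation.{u}) : Category.{u} (Classifying E) where
  Hom X Y := ∀ i : Fin Y.seq.len, TermClass E X.seq (Y.seq.entry i)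
  id X := fun i => cls E (Term.generic i)
  comp f g := fun i => TermClass.cmp f (g i)
  id_comp f := by
    obtain ⟨a, rfl⟩ := exists_rep f
    funext i
    rw [TermClass.cmp_cls, Term.cmp_generic]
  comp_id f := by
    obtain ⟨a, rfl⟩ := exists_rep f
    funext i
    rw [TermClass.cmp_cls, Term.generic_cmp]
  assoc f g h := by
    obtain ⟨a, rfl⟩ := exists_rep f
    obtain ⟨b, rfl⟩ := exists_rep g
    obtain ⟨c, rfl⟩ := exists_rep h
    funext i
    simp only [TermClass.cmp_cls, Term.cmp_cmp]

/-! ### The second-order theory of equality and the algebraic theory of a presentation -/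

/-- The presentation with no operators and no axioms. -/
def emptyPresentation : Presentation.{0} := ⟨⟨Empty, Empty.elim⟩, ∅⟩

/-- The second-order theory of equality `𝕄`: the classifying category of the presentation with no
operators and no axioms, whose morphisms are tuples of elementary terms. -/
abbrev EqualityTheory : Type := Classifying emptyPresentation

/-- An elementary term regarded as a term over an arbitrary signature. -/
def Term.ofElementary (S : Signature.{u}) {Θ : NatSeq} :
    {n : ℕ} → Term emptyPresentation.sig Θ n → Term S Θ n
  | _, .var x => .var x
  | _, .mvar i ts => .mvar i (fun j => (ts j).ofElementary S)
  | _, .op ω _ => Empty.elim ω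

theorem Term.ofElementary_ren (S : Signature.{u}) {n m : ℕ} (f : Fin n → Fin m)
    (t : Term emptyPresentation.sig Θ n) :
    (t.ren f).ofElementary S = (t.ofElementary S).ren f := by
  induction t generalizing m with
  | var x => rfl
  | mvar i ts ih => simp [ren, ofElementary, ih]
  | op ω ts ih => exact Empty.elim ω

theorem Term.ofElementary_subst (S : Signature.{u}) {n m : ℕ}
    (σ : Fin n → Term emptyPresentation.sig Θ m) (t : Term emptyPresentation.sig Θ n) :
    (t.subst σ).ofElementary S = (t.ofElementary S).subst (fun x => (σ x).ofElementary S) := by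
  induction t generalizing m with
  | var x => rfl
  | mvar i ts ih => simp [subst, ofElementary, ih]
  | op ω ts ih => exact Empty.elim ω

theorem Term.ofElementary_msub (S : Signature.{u}) {n : ℕ}
    (s : ∀ i : Fin Θ.len, Term emptyPresentation.sig Θ' (n + Θ.entry i))
    (t : Term emptyPresentation.sig Θ n) :
    (t.msub s).ofElementary S = (t.ofElementary S).msub (fun i => (s i).ofElementary S) := by
  induction t with
  | var x => rfl
  | mvar i ts ih =>
    simp only [msub, ofElementary, ofElementary_subst]
    congr 1; funext x
    induction x using Fin.addCases <;> simp [ofElementary, ih]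
  | op ω ts ih => exact Empty.elim ω

theorem Derivable.ofElementary (E : Presentation.{u}) {n : ℕ}
    {s t : Term emptyPresentation.sig Θ n} (h : Derivable emptyPresentation s t) :
    Derivable E (s.ofElementary E.sig) (t.ofElementary E.sig) := by
  induction h with
  | ax e he => exact absurd he (Set.notMem_empty e)
  | refl t => exact Derivable.refl _
  | symm _ ih => exact ih.symm
  | trans _ _ ih₁ ih₂ => exact ih₁.trans ih₂
  | extMsub _ _ ih₁ ih₂ =>
    simp only [Term.extMsub, Term.ofElementary_msub, Term.ofElementary_ren]
    exact Derivable.extMsub ih₁ ih₂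

/-- The second-order algebraic theory `M_E : 𝕄 ⥤ 𝕄(E)` of a presentation: the identity on
objects, and the inclusion of elementary terms on morphisms. -/
noncomputable def theoryOf (E : Presentation.{u}) : EqualityTheory ⥤ Classifying E where
  obj X := ⟨X.seq⟩
  map {X Y} f := fun i =>
    Quotient.map (sa := derivableSetoid emptyPresentation X.seq (Y.seq.entry i))
      (sb := derivableSetoid E X.seq (Y.seq.entry i))
      (Term.ofElementary E.sig) (fun _ _ h => h.ofElementary E) (f i)
  map_id X := rfl
  map_comp {X Y Z} f g := by
    obtain ⟨a, rfl⟩ := exists_rep f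
    obtain ⟨b, rfl⟩ := exists_rep g
    funext i
    change Quotient.map _ _ (TermClass.cmp _ _) =
      TermClass.cmp (fun p => cls E ((a p).ofElementary E.sig)) (cls E ((b i).ofElementary E.sig))
    rw [TermClass.cmp_cls, TermClass.cmp_cls]
    change cls E _ = cls E _
    simp only [Term.cmp, Term.ofElementary_msub, Term.ofElementary_ren]

/-- The property of being a cartesian functor, i.e. of preserving finite products. -/
def isCartesian (A : Type w) [Category.{v} A] (C : Type w') [Category.{v'} C] :
    ObjectProperty (A ⥤ C) :=
  fun F => PreservesFiniteProducts F

/-- The category of functorial models in `C` of a theory `M : 𝕄 ⥤ 𝕃`: cartesian functors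
`𝕃 ⥤ C` and all natural transformations between them (a natural transformation between
product-preserving functors is automatically monoidal for the cartesian structures). -/
abbrev FMod {L : Type w} [Category.{v} L] (_M : EqualityTheory ⥤ L)
    (C : Type w') [Category.{v'} C] :=
  (isCartesian L C).FullSubcategory

/-! ### Clones -/

/-- A clone in a category with finite products. -/
structure Clone (C : Type w) [Category.{v} C] [HasFiniteProducts C] where
  /-- The objects `C_n`. -/
  obj : ℕ → C
  /-- The variable maps `1 ⟶ C_n`. -/
  ι (n : ℕ) (i : Fin n) : ⊤_ C ⟶ obj n
  /-- The substitution maps `C_m × (C_n)^m ⟶ C_n`. -/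
  ς (m n : ℕ) : obj m ⨯ (∏ᶜ fun _ : Fin m => obj n) ⟶ obj n
  ς_ι (n : ℕ) :
    prod.map (𝟙 (obj n)) (Pi.lift (fun i : Fin n => ι n i)) ≫ ς n n = prod.fst
  ι_ς (m n : ℕ) (i : Fin m) :
    prod.map (ι m i) (𝟙 (∏ᶜ fun _ : Fin m => obj n)) ≫ ς m n = prod.snd ≫ Pi.π _ i
  ς_ς (l m n : ℕ) :
    (prod.associator (obj l) (∏ᶜ fun _ : Fin l => obj m) (∏ᶜ fun _ : Fin m => obj n)).inv ≫
        prod.map (ς l m) (𝟙 _) ≫ ς m n =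
      prod.map (𝟙 (obj l))
          (Pi.lift (fun i : Fin l =>
            prod.map (Pi.π (fun _ : Fin l => obj m) i) (𝟙 (∏ᶜ fun _ : Fin m => obj n)) ≫
              ς m n)) ≫
        ς l n

namespace Clone

variable {C : Type w} [Category.{v} C] [HasFiniteProducts C]

/-- The canonical action `C_f : C_m ⟶ C_n` of a map `f : {1, …, m} → {1, …, n}`. -/
noncomputable def act (A : Clone C) {m n : ℕ} (f : Fin m → Fin n) : A.obj m ⟶ A.obj n :=
  prod.lift (𝟙 _) (terminal.from _ ≫ Pi.lift (fun i => A.ι n (f i))) ≫ A.ς m n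

/-- The morphism `υ_k : (C_m)^n ⟶ (C_{m+k})^{n+k}`: the weakening of the `n` given components,
followed by the last `k` variables. -/
noncomputable def υ (A : Clone C) (m n k : ℕ) :
    (∏ᶜ fun _ : Fin n => A.obj m) ⟶ ∏ᶜ fun _ : Fin (n + k) => A.obj (m + k) :=
  Pi.lift (Fin.append
    (fun i : Fin n => Pi.π (fun _ : Fin n => A.obj m) i ≫ A.act (Fin.castAdd k))
    (fun i : Fin k => terminal.from _ ≫ A.ι (m + k) (Fin.natAdd m i)))

end Clone

/-- A clone for a second-order signature `S` in a category with finite products. -/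
structure SigClone (S : Signature.{u}) (C : Type w) [Category.{v} C] [HasFiniteProducts C]
    extends Clone C where
  /-- The operator maps `ω̃_n : S_{n+n₁} × ⋯ × S_{n+n_l} ⟶ S_n`. -/
  opMap (ω : S.Op) (n : ℕ) :
    (∏ᶜ fun i : Fin (S.arity ω).len => obj (n + (S.arity ω).entry i)) ⟶ obj n
  opMap_natural (ω : S.Op) {m n : ℕ} (f : Fin m → Fin n) :
    Limits.Pi.map (fun i => toClone.act (up f ((S.arity ω).entry i))) ≫ opMap ω n =
      opMap ω m ≫ toClone.act f
  opMap_ς (ω : S.Op) (n m : ℕ) :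
    prod.map (opMap ω n) (𝟙 (∏ᶜ fun _ : Fin n => obj m)) ≫ ς n m =
      Pi.lift (fun i =>
          prod.map (Pi.π (fun i => obj (n + (S.arity ω).entry i)) i)
              (toClone.υ m n ((S.arity ω).entry i)) ≫
            ς (n + (S.arity ω).entry i) (m + (S.arity ω).entry i)) ≫
        opMap ω m

namespace SigClone

variable {S : Signature.{u}} {C : Type w} [Category.{v} C] [HasFiniteProducts C]

/-- Homomorphisms of `S`-clones: families of maps that commute with the variable maps, the
substitution maps and the operator maps. -/
@[ext] structure Hom (A B : SigClone S C) where
  /-- The components. -/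
  app (n : ℕ) : A.obj n ⟶ B.obj n
  ι_app (n : ℕ) (i : Fin n) : A.ι n i ≫ app n = B.ι n i
  ς_app (m n : ℕ) :
    A.ς m n ≫ app n = prod.map (app m) (Limits.Pi.map (fun _ => app n)) ≫ B.ς m n
  opMap_app (ω : S.Op) (n : ℕ) :
    A.opMap ω n ≫ app n =
      Limits.Pi.map (fun i => app (n + (S.arity ω).entry i)) ≫ B.opMap ω n

/-- The category of `S`-clones in `C`. -/
instance : Category.{v} (SigClone S C) where
  Hom := Hom
  id A :=
    { app := fun n => 𝟙 (A.obj n)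
      ι_app := fun n i => by simp
      ς_app := fun m n => by simp
      opMap_app := fun ω n => by simp }
  comp f g :=
    { app := fun n => f.app n ≫ g.app n
      ι_app := fun n i => by rw [← Category.assoc, f.ι_app, g.ι_app]
      ς_app := fun m n => by
        rw [← Category.assoc, f.ς_app, Category.assoc, g.ς_app, ← Category.assoc, prod.map_map]
        congr 2
        ext i
        simp
      opMap_app := fun ω n => by
        rw [← Category.assoc, f.opMap_app, Category.assoc, g.opMap_app, ← Category.assoc]
        congr 1
        ext i
        simp }
  id_comp f := by apply Hom.ext; funext n; simp
  comp_id f := by apply Hom.ext; funext n; simp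
  assoc f g h := by apply Hom.ext; funext n; simp

/-- The interpretation `∏_i S_{m_i} ⟶ S_n` of a term
`𝗆₁ : [m₁], …, 𝗆_k : [m_k] ▹ x₁, …, x_n ⊢ t` in an `S`-clone. -/
noncomputable def interp (A : SigClone S C) {Θ : NatSeq} : {n : ℕ} → Term S Θ n →
    ((∏ᶜ fun i : Fin Θ.len => A.obj (Θ.entry i)) ⟶ A.obj n)
  | n, .var x => terminal.from _ ≫ A.ι n x
  | n, .mvar i ts =>
      prod.lift (Pi.π _ i) (Pi.lift (fun j => A.interp (ts j))) ≫ A.ς (Θ.entry i) n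
  | n, .op ω ts => Pi.lift (fun i => A.interp (ts i)) ≫ A.opMap ω n

/-- An `S`-clone satisfies an equation `Θ ▹ Γ ⊢ s ≡ t` if for every `d` the two sides, extended
by `d` variables, have equal interpretations
`∏_i S_{m_i + d} ⟶ S_{n + d}`. For `d = 0` these are the interpretations of `s` and `t`
themselves (`Term.extend_zero`); the general `d` says that the equation also holds in the presence
of `d` further variables, as it does for models in the presheaf category. -/
def Satisfies (A : SigClone S C) (e : Equation S) : Prop :=
  ∀ d : ℕ, A.interp (e.lhs.extend d) = A.interp (e.rhs.extend d)

end SigClone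

/-- The `S`-clones that satisfy the axioms of a presentation. -/
def satisfiesAxioms (E : Presentation.{u}) (C : Type w) [Category.{v} C] [HasFiniteProducts C] :
    ObjectProperty (SigClone E.sig C) :=
  fun A => ∀ e ∈ E.axs, A.Satisfies e

/-- The category of `E`-clones in `C`: the full subcategory of the clones for the signature of `E`
that satisfy the axioms of `E`. -/
abbrev EClone (E : Presentation.{u}) (C : Type w) [Category.{v} C] [HasFiniteProducts C] :=
  (satisfiesAxioms E C).FullSubcategory

end SecondOrder

/-! The object $(m_1,\dots,m_k)$ of $\mathbb M(\mathcal E)$ is the product of the objects $(m_i)$,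
so a cartesian functor $F$ is determined by the objects $F(n)$ together with its action on classes
of terms. Terms are built from variables, substitution into metavariables and operators, so this
action amounts to a clone structure on the $F(n)$. The functor `modelFunctor` sends a clone $S$ to
$(m_1,\dots,m_k)\mapsto\prod_i S_{m_i}$, a class of terms acting by its interpretation. It is shown
to be full, faithful and essentially surjective.

Well-definedness is soundness of the equational logic. The metasubstitution rule adjoins a context
$\Delta$ of parameters to the values of metavariables, so equality of plain interpretations is too
weak an induction hypothesis. Terms are therefore evaluated in environments whose values live over
$d$ parameters, and the invariant is agreement in all of these (`AbstractClone.Valid`). The rule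
preserves it by `AbstractClone.eval_extMsub`. The axioms have it because an environment over $d$
parameters is a substitution instance of the interpretation of the extension by $d$ variables
(`AbstractClone.Valid.of_interp_extend`). All this is done for clones of sets and applied to the
generalized elements `SigClone.elements`; evaluating at the projections of a product recovers the
morphisms of $\mathcal C$.

For full faithfulness, substitution and operators are themselves interpretations of generic terms,
so the components at $(n)$ of a natural transformation form a homomorphism
(`EClone.interp_component`), and the projections determine the rest. For essential surjectivity, the
clone operations on the $F(n)$ are the values of the same generic terms. Finitely many generalized
elements are always values of terms at common arguments (`Model.exists_eq_value`), so each clone law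
reduces to an identity of the substitution calculus. Finally, interpretation in this clone is the
action of $F$ (`Model.interp_clone`), which gives both the axioms and the isomorphism with $F$. -/

namespace SecondOrder

/-! ### Abstract clones in sets and environment semantics -/

/-- A clone for a second-order signature in the category of types, presented by functions. -/
structure AbstractClone (S : Signature.{u}) where
  /-- The elements in a context of `n` variables. -/
  carrier : ℕ → Type v
  /-- The variables. -/
  var {n : ℕ} : Fin n → carrier n
  /-- Simultaneous substitution. -/
  sub {m n : ℕ} : carrier m → (Fin m → carrier n) → carrier n
  /-- The operators. -/
  op (ω : S.Op) {n : ℕ} :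
    (∀ i : Fin (S.arity ω).len, carrier (n + (S.arity ω).entry i)) → carrier n
  sub_var {n : ℕ} (t : carrier n) : sub t var = t
  var_sub {m n : ℕ} (i : Fin m) (a : Fin m → carrier n) : sub (var i) a = a i
  sub_sub {l m n : ℕ} (t : carrier l) (a : Fin l → carrier m) (b : Fin m → carrier n) :
    sub (sub t a) b = sub t (fun i => sub (a i) b)
  op_sub (ω : S.Op) {n m : ℕ}
    (ts : ∀ i : Fin (S.arity ω).len, carrier (n + (S.arity ω).entry i)) (a : Fin n → carrier m) :
    sub (op ω ts) a = op ω (fun i => sub (ts i)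
      (Fin.append (fun x => sub (a x) (fun y => var (Fin.castAdd ((S.arity ω).entry i) y)))
        (fun z => var (Fin.natAdd m z))))

namespace AbstractClone

variable {S : Signature.{u}} (A : AbstractClone.{u, v} S) {Θ Θ' : NatSeq}

/-- The action of a renaming. -/
def act {m n : ℕ} (f : Fin m → Fin n) (t : A.carrier m) : A.carrier n :=
  A.sub t (fun x => A.var (f x))

/-- Extension of a substitution by `k` fresh variables. -/
def lift {n m : ℕ} (a : Fin n → A.carrier m) (k : ℕ) : Fin (n + k) → A.carrier (m + k) :=
  Fin.append (fun x => A.act (Fin.castAdd k) (a x)) (fun z => A.var (Fin.natAdd m z))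

@[simp] theorem lift_castAdd {n m : ℕ} (a : Fin n → A.carrier m) (k : ℕ) (x : Fin n) :
    A.lift a k (Fin.castAdd k x) = A.act (Fin.castAdd k) (a x) := by
  simp [lift]

@[simp] theorem lift_natAdd {n m : ℕ} (a : Fin n → A.carrier m) (k : ℕ) (x : Fin k) :
    A.lift a k (Fin.natAdd n x) = A.var (Fin.natAdd m x) := by
  simp [lift]

theorem sub_op {n m : ℕ} (ω : S.Op)
    (ts : ∀ i : Fin (S.arity ω).len, A.carrier (n + (S.arity ω).entry i))
    (a : Fin n → A.carrier m) :
    A.sub (A.op ω ts) a = A.op ω (fun i => A.sub (ts i) (A.lift a _)) :=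
  A.op_sub ω ts a

theorem lift_var (n k : ℕ) : A.lift (A.var (n := n)) k = A.var := by
  funext x
  induction x using Fin.addCases <;> simp [act, var_sub]

theorem lift_lift {l m n : ℕ} (a : Fin l → A.carrier m) (b : Fin m → A.carrier n) (k : ℕ)
    (x : Fin (l + k)) :
    A.sub (A.lift a k x) (A.lift b k) = A.lift (fun y => A.sub (a y) b) k x := by
  induction x using Fin.addCases <;> simp [act, var_sub, sub_sub]

theorem act_sub {l m n : ℕ} (f : Fin l → Fin m) (t : A.carrier l) (a : Fin m → A.carrier n) :
    A.sub (A.act f t) a = A.sub t (fun x => a (f x)) := by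
  simp [act, sub_sub, var_sub]

theorem sub_act {l m n : ℕ} (f : Fin m → Fin n) (t : A.carrier l) (a : Fin l → A.carrier m) :
    A.act f (A.sub t a) = A.sub t (fun x => A.act f (a x)) := by
  simp [act, sub_sub]

theorem act_act {l m n : ℕ} (f : Fin l → Fin m) (g : Fin m → Fin n) (t : A.carrier l) :
    A.act g (A.act f t) = A.act (fun x => g (f x)) t := by
  simp [act, sub_sub, var_sub]

@[simp] theorem act_var {m n : ℕ} (f : Fin m → Fin n) (x : Fin m) :
    A.act f (A.var x) = A.var (f x) := by
  simp [act, var_sub]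

/-- The value of a term in an environment over `d` parameters, which assigns to each variable an
element in context `d` and to each metavariable an element in context `d` extended by its
arguments. -/
def eval (A : AbstractClone.{u, v} S) : {n : ℕ} → Term S Θ n → {d : ℕ} → (∀ i : Fin Θ.len, A.carrier (d + Θ.entry i)) →
    (Fin n → A.carrier d) → A.carrier d
  | _, .var x, _, _, σ => σ x
  | _, .mvar i ts, _, ρ, σ => A.sub (ρ i) (Fin.append A.var (fun j => A.eval (ts j) ρ σ))
  | _, .op ω ts, _, ρ, σ => A.op ω (fun i => A.eval (ts i)
      (fun p => A.act (up (Fin.castAdd ((S.arity ω).entry i)) (Θ.entry p)) (ρ p)) (A.lift σ _))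

/-- Evaluation is natural in the parameters. Under a binder this rests on weakening by the bound
variables commuting with the lifted substitution. -/
theorem sub_eval {n d d' : ℕ} (t : Term S Θ n) (ρ : ∀ i : Fin Θ.len, A.carrier (d + Θ.entry i))
    (σ : Fin n → A.carrier d) (a : Fin d → A.carrier d') :
    A.sub (A.eval t ρ σ) a =
      A.eval t (fun p => A.sub (ρ p) (A.lift a _)) (fun x => A.sub (σ x) a) := by
  induction t generalizing d d' with
  | var x => rfl
  | mvar i ts ih =>
    simp only [eval, sub_sub]
    congr 1; funext x
    induction x using Fin.addCases <;> simp [ih, var_sub, act_sub, sub_var]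
  | op ω ts ih =>
    simp only [eval, sub_op, ih, lift_lift]
    congr 1; funext i; congr 1; funext p
    rw [act_sub, sub_act]
    congr 1; funext x
    induction x using Fin.addCases <;> simp [act_act]

theorem eval_ren {n m d : ℕ} (f : Fin n → Fin m) (t : Term S Θ n)
    (ρ : ∀ i : Fin Θ.len, A.carrier (d + Θ.entry i)) (σ : Fin m → A.carrier d) :
    A.eval (t.ren f) ρ σ = A.eval t ρ (fun x => σ (f x)) := by
  induction t generalizing m d with
  | var x => rfl
  | mvar i ts ih => simp only [Term.ren, eval, ih]
  | op ω ts ih =>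
    simp only [Term.ren, eval, ih]
    congr 1; funext i; congr 1; funext x
    induction x using Fin.addCases <;> simp

theorem act_eval {n d d' : ℕ} (t : Term S Θ n) (ρ : ∀ i : Fin Θ.len, A.carrier (d + Θ.entry i))
    (σ : Fin n → A.carrier d) (f : Fin d → Fin d') :
    A.act f (A.eval t ρ σ) =
      A.eval t (fun p => A.act (up f _) (ρ p)) (fun x => A.act f (σ x)) := by
  unfold act
  rw [sub_eval]
  congr 1; funext p; congr 1; funext x
  induction x using Fin.addCases <;> simp

theorem eval_subst {n m d : ℕ} (τ : Fin n → Term S Θ m) (t : Term S Θ n)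
    (ρ : ∀ i : Fin Θ.len, A.carrier (d + Θ.entry i)) (σ : Fin m → A.carrier d) :
    A.eval (t.subst τ) ρ σ = A.eval t ρ (fun x => A.eval (τ x) ρ σ) := by
  induction t generalizing m d with
  | var x => rfl
  | mvar i ts ih => simp only [Term.subst, eval, ih]
  | op ω ts ih =>
    simp only [Term.subst, eval, ih]
    congr 1; funext i; congr 1; funext x
    induction x using Fin.addCases <;> simp [eval_ren, act_eval, eval]

/-- The value given to a metavariable is the term replacing it, evaluated with the arguments
adjoined as fresh parameters; applying it to actual arguments is then an instance of `sub_eval`. -/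
theorem eval_msub {n d : ℕ} (s : ∀ i : Fin Θ.len, Term S Θ' (n + Θ.entry i)) (t : Term S Θ n)
    (ρ : ∀ i : Fin Θ'.len, A.carrier (d + Θ'.entry i)) (σ : Fin n → A.carrier d) :
    A.eval (t.msub s) ρ σ =
      A.eval t (fun p => A.eval (s p) (fun q => A.act (up (Fin.castAdd (Θ.entry p)) _) (ρ q))
        (A.lift σ _)) σ := by
  induction t generalizing d with
  | var x => rfl
  | mvar i ts ih =>
    simp only [Term.msub, eval, eval_subst, sub_eval]
    congr 1
    · funext q
      -- The substitution undoes the weakening of `ρ q`: it is the identity on the old parameters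
      -- and on the arguments of `q`.
      rw [act_sub]
      conv_lhs => rw [← A.sub_var (ρ q)]
      congr 1; funext x
      induction x using Fin.addCases <;> simp
    · funext x
      induction x using Fin.addCases <;> simp [ih, var_sub, eval, act_sub, sub_var]
  | op ω ts ih =>
    simp only [Term.msub, eval, ih, eval_ren]
    congr 1; funext i; congr 1; funext p
    rw [act_eval]
    congr 1
    · funext q
      simp only [act_act, up_up]
      congr 1; funext x
      induction x using Fin.addCases <;> simp
    · funext x
      induction x using Fin.addCases <;> simp [act_act]

/-- The semantic form of the inference rule: the $\Gamma$-part of `σ` evaluates `t`, while the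
$\Delta$-part is absorbed into the values of the metavariables. This is why these values must be
allowed parameters. -/
theorem eval_extMsub {n k d : ℕ} (s : ∀ i : Fin Θ.len, Term S Θ' (k + Θ.entry i))
    (t : Term S Θ n) (ρ : ∀ i : Fin Θ'.len, A.carrier (d + Θ'.entry i))
    (σ : Fin (n + k) → A.carrier d) :
    A.eval (t.extMsub s) ρ σ =
      A.eval t (fun p => A.eval (s p) (fun q => A.act (up (Fin.castAdd (Θ.entry p)) _) (ρ q))
        (A.lift (fun x => σ (Fin.natAdd n x)) _)) (fun x => σ (Fin.castAdd k x)) := by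
  simp only [Term.extMsub, eval_msub, eval_ren]
  congr 1; funext p; congr 1; funext x
  induction x using Fin.addCases <;> simp

/-- The interpretation of a term, with the metavariables interpreted by elements without
parameters. -/
def interp (A : AbstractClone.{u, v} S) (ρ : ∀ i : Fin Θ.len, A.carrier (Θ.entry i)) : {n : ℕ} → Term S Θ n → A.carrier n
  | _, .var x => A.var x
  | _, .mvar i ts => A.sub (ρ i) (fun j => A.interp ρ (ts j))
  | _, .op ω ts => A.op ω (fun i => A.interp ρ (ts i))

/-- The variables of the term act as their own parameters, so `d = n`, and the values in `ρ` are
weakened by them. -/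
theorem interp_eq_eval {n : ℕ} (ρ : ∀ i : Fin Θ.len, A.carrier (Θ.entry i)) (t : Term S Θ n) :
    A.interp ρ t = A.eval t (fun p => A.act (Fin.natAdd n) (ρ p)) A.var := by
  induction t with
  | var x => rfl
  | mvar i ts ih => simp [interp, eval, ih, act_sub]
  | op ω ts ih => simp [interp, eval, ih, act_act, lift_var]

theorem interp_generic (ρ : ∀ i : Fin Θ.len, A.carrier (Θ.entry i)) (i : Fin Θ.len) :
    A.interp ρ (Term.generic i) = ρ i :=
  A.sub_var _

/-- This becomes functoriality of the model of a clone. -/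
theorem interp_cmp {n : ℕ} (ρ : ∀ i : Fin Θ'.len, A.carrier (Θ'.entry i))
    (s : ∀ p : Fin Θ.len, Term S Θ' (Θ.entry p)) (t : Term S Θ n) :
    A.interp ρ (t.cmp s) = A.interp (fun p => A.interp ρ (s p)) t := by
  simp only [interp_eq_eval, Term.cmp, eval_msub, eval_ren, act_eval]
  congr 1; funext p; congr 1
  · funext q
    simp only [act_act]
    congr 1; funext x; simp
  · funext x; simp

/-- Two terms agree in all environments. -/
def Valid {n : ℕ} (s t : Term S Θ n) : Prop :=
  ∀ ⦃d : ℕ⦄ (ρ : ∀ i : Fin Θ.len, A.carrier (d + Θ.entry i)) (σ : Fin n → A.carrier d),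
    A.eval s ρ σ = A.eval t ρ σ

theorem eval_shiftGeneric {d e : ℕ} (i : Fin Θ.len)
    (ρ : ∀ i : Fin (Θ.shift d).len, A.carrier (e + (Θ.shift d).entry i))
    (σ : Fin (d + Θ.entry i) → A.carrier e) :
    A.eval (Term.shiftGeneric S Θ d i) ρ σ =
      A.sub (ρ i) (Fin.append A.var (Fin.append (fun y => σ (Fin.natAdd d y))
        (fun x => σ (Fin.castAdd (Θ.entry i) x)))) := by
  refine congrArg (fun f => A.sub (ρ i) (Fin.append A.var f)) ?_
  funext j
  change Fin (Θ.entry i + d) at j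
  induction j using Fin.addCases <;> simp [eval]

/-- The extra variables of the extension play the part of the parameters, so the parameterless
hypotheses for all `d` control every environment. -/
theorem Valid.of_interp_extend {n : ℕ} {s t : Term S Θ n}
    (h : ∀ (d : ℕ) (ρ : ∀ i : Fin (Θ.shift d).len, A.carrier ((Θ.shift d).entry i)),
      A.interp ρ (s.extend d) = A.interp ρ (t.extend d)) :
    A.Valid s t := by
  intro d ρ σ
  -- Environments list parameters before arguments, while the metavariables of the extension take
  -- their arguments first; the renaming swaps the two blocks.
  let ρ' : ∀ i : Fin (Θ.shift d).len, A.carrier ((Θ.shift d).entry i) := fun i =>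
    A.act (Fin.append (Fin.natAdd (Θ.entry i)) (Fin.castAdd d)) (ρ i)
  -- Substituting `σ` for the original variables and the parameters for the extra ones recovers the
  -- given environment.
  have key : ∀ r : Term S Θ n, A.eval r ρ σ =
      A.sub (A.interp ρ' (r.extend d)) (Fin.append σ A.var) := by
    intro r
    rw [interp_eq_eval, Term.extend, eval_extMsub, sub_eval]
    congr 1
    · funext p
      rw [eval_shiftGeneric, act_act]
      change _ = A.sub (A.sub (A.act _ (A.act _ (ρ p))) _) _
      simp only [act_sub, sub_sub]
      conv_lhs => rw [← A.sub_var (ρ p)]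
      congr 1; funext x
      induction x using Fin.addCases with
      | left x =>
        erw [up_natAdd, Fin.append_right, Fin.append_left, Fin.append_right]
        simp [var_sub]
      | right x =>
        erw [up_natAdd, Fin.append_right, Fin.append_right, Fin.append_left]
        simp [var_sub]
    · funext x
      simp [var_sub]
  rw [key, key, h]

end AbstractClone

/-- Induction on derivations; in the metasubstitution case the first premise is used in an
environment whose metavariable values are the evaluated second premises. -/
theorem Derivable.valid {E : Presentation.{u}} {A : AbstractClone.{u, v} E.sig}
    (hA : ∀ e ∈ E.axs, A.Valid e.lhs e.rhs) {Θ : NatSeq} {n : ℕ} {s t : Term E.sig Θ n}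
    (h : Derivable E s t) : A.Valid s t := by
  induction h with
  | ax e he => exact hA e he
  | refl t => exact fun _ _ _ => rfl
  | symm _ ih => exact fun _ ρ σ => (ih ρ σ).symm
  | trans _ _ ih₁ ih₂ => exact fun _ ρ σ => (ih₁ ρ σ).trans (ih₂ ρ σ)
  | extMsub _ _ ih₁ ih₂ =>
    intro d ρ σ
    rw [A.eval_extMsub, A.eval_extMsub, ih₁]
    congr 1; funext p
    exact ih₂ p _ _

theorem Derivable.interp_eq {E : Presentation.{u}} {A : AbstractClone.{u, v} E.sig}
    (hA : ∀ e ∈ E.axs, A.Valid e.lhs e.rhs) {Θ : NatSeq} {n : ℕ} {s t : Term E.sig Θ n}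
    (h : Derivable E s t) (ρ : ∀ i : Fin Θ.len, A.carrier (Θ.entry i)) :
    A.interp ρ s = A.interp ρ t := by
  rw [A.interp_eq_eval, A.interp_eq_eval]
  exact h.valid hA _ _

end SecondOrder

namespace SecondOrder

/-! ### Generalized elements of a clone -/

namespace SigClone

variable {S : Signature.{u}} {C : Type w} [Category.{v} C] [HasFiniteProducts C]

section

variable (A : SigClone S C) {X Y : C}

/-- The variables as generalized elements. -/
noncomputable def evar (X : C) {n : ℕ} (i : Fin n) : X ⟶ A.obj n :=
  terminal.from X ≫ A.ι n i

/-- Substitution of generalized elements. -/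
noncomputable def esub {m n : ℕ} (t : X ⟶ A.obj m) (a : Fin m → (X ⟶ A.obj n)) : X ⟶ A.obj n :=
  prod.lift t (Pi.lift a) ≫ A.ς m n

/-- The operators on generalized elements. -/
noncomputable def eop (ω : S.Op) {n : ℕ}
    (ts : ∀ i : Fin (S.arity ω).len, X ⟶ A.obj (n + (S.arity ω).entry i)) : X ⟶ A.obj n :=
  Pi.lift ts ≫ A.opMap ω n

theorem comp_piLift {J : Type*} [Finite J] {Z : J → C} (g : Y ⟶ X) (a : ∀ j, X ⟶ Z j) :
    g ≫ Pi.lift a = Pi.lift (fun j => g ≫ a j) := by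
  ext; simp

theorem comp_piLift_assoc {J : Type*} [Finite J] {W : C} {Z : J → C} (g : Y ⟶ X)
    (a : ∀ j, X ⟶ Z j) (k : ∏ᶜ Z ⟶ W) :
    g ≫ Pi.lift a ≫ k = Pi.lift (fun j => g ≫ a j) ≫ k := by
  rw [← Category.assoc, comp_piLift]

theorem piLift_π (J : Type*) [Finite J] (Z : J → C) : Pi.lift (Pi.π Z) = 𝟙 (∏ᶜ Z) := by
  ext; simp

/-- Here and in the following laws, the clone axiom in $\mathcal C$ is precomposed with the tuple of
the given generalized elements. -/
theorem esub_evar {n : ℕ} (t : X ⟶ A.obj n) : A.esub t (A.evar X) = t := by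
  have h := congrArg (fun f => prod.lift t (terminal.from X) ≫ f) (A.ς_ι n)
  simp only [prod.lift_map_assoc, Category.comp_id, comp_piLift, prod.lift_fst] at h
  exact h

theorem evar_esub {m n : ℕ} (i : Fin m) (a : Fin m → (X ⟶ A.obj n)) :
    A.esub (A.evar X i) a = a i := by
  have h := congrArg (fun f => prod.lift (terminal.from X) (Pi.lift a) ≫ f) (A.ι_ς m n i)
  simpa [esub, evar, prod.lift_snd_assoc] using h

theorem esub_esub {l m n : ℕ} (t : X ⟶ A.obj l) (a : Fin l → (X ⟶ A.obj m))
    (b : Fin m → (X ⟶ A.obj n)) :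
    A.esub (A.esub t a) b = A.esub t (fun i => A.esub (a i) b) := by
  have h := congrArg (fun f => prod.lift t (prod.lift (Pi.lift a) (Pi.lift b)) ≫ f) (A.ς_ς l m n)
  simpa [comp_piLift, prod.comp_lift_assoc, prod.comp_lift, prod.lift_fst, prod.lift_snd,
    prod.lift_fst_assoc, prod.lift_snd_assoc, esub] using h

theorem comp_act {m n : ℕ} (t : X ⟶ A.obj m) (f : Fin m → Fin n) :
    t ≫ A.act f = A.esub t (fun x => A.evar X (f x)) := by
  simp only [Clone.act, esub, evar, ← Category.assoc, prod.comp_lift, comp_piLift,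
    Category.comp_id, terminal.comp_from]

theorem comp_υ {m n : ℕ} (a : Fin n → (X ⟶ A.obj m)) (k : ℕ) :
    Pi.lift a ≫ A.υ m n k = Pi.lift (Fin.append
      (fun x => A.esub (a x) (fun y => A.evar X (Fin.castAdd k y)))
      (fun z => A.evar X (Fin.natAdd m z))) := by
  ext x
  induction x using Fin.addCases with
  | left x => simp [Clone.υ, ← comp_act]
  | right x => simp [Clone.υ, evar]

theorem eop_esub (ω : S.Op) {n m : ℕ}
    (ts : ∀ i : Fin (S.arity ω).len, X ⟶ A.obj (n + (S.arity ω).entry i))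
    (a : Fin n → (X ⟶ A.obj m)) :
    A.esub (A.eop ω ts) a = A.eop ω (fun i => A.esub (ts i)
      (Fin.append (fun x => A.esub (a x) (fun y => A.evar X (Fin.castAdd ((S.arity ω).entry i) y)))
        (fun z => A.evar X (Fin.natAdd m z)))) := by
  have h := congrArg (fun f => prod.lift (Pi.lift ts) (Pi.lift a) ≫ f) (A.opMap_ς ω n m)
  simpa [comp_piLift_assoc, comp_υ, esub, eop] using h

/-- The generalized elements of a clone at a fixed stage. -/
noncomputable abbrev elements (X : C) : AbstractClone.{u, v} S where
  carrier n := X ⟶ A.obj n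
  var := A.evar X
  sub := A.esub
  op ω _ := A.eop ω
  sub_var := A.esub_evar
  var_sub := A.evar_esub
  sub_sub := A.esub_esub
  op_sub := A.eop_esub

variable {Θ Θ' : NatSeq}

/-- The bridge between morphisms of $\mathcal C$ and set-level clones, through which results on
`AbstractClone.interp` are transferred. -/
theorem lift_interp {n : ℕ} (ρ : ∀ i : Fin Θ.len, X ⟶ A.obj (Θ.entry i)) (t : Term S Θ n) :
    Pi.lift ρ ≫ A.interp t = (A.elements X).interp ρ t := by
  induction t with
  | var x => simp [interp, AbstractClone.interp, evar]
  | mvar i ts ih =>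
    simp only [interp, AbstractClone.interp, ← ih]
    simp [esub, ← Category.assoc, prod.comp_lift, comp_piLift]
  | op ω ts ih =>
    simp only [interp, AbstractClone.interp, ← ih]
    simp [eop, ← Category.assoc, comp_piLift]

theorem interp_generic (i : Fin Θ.len) :
    A.interp (Term.generic i) = Pi.π (fun i : Fin Θ.len => A.obj (Θ.entry i)) i := by
  have h := A.lift_interp (fun i => Pi.π (fun i : Fin Θ.len => A.obj (Θ.entry i)) i)
    (Term.generic i)
  rw [(A.elements _).interp_generic, piLift_π, Category.id_comp] at h
  exact h

theorem interp_cmp {n : ℕ} (s : ∀ p : Fin Θ.len, Term S Θ' (Θ.entry p)) (t : Term S Θ n) :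
    A.interp (t.cmp s) = Pi.lift (fun p => A.interp (s p)) ≫ A.interp t := by
  -- The tuple of projections is the identity, so the morphism is its own value at the universal
  -- generalized elements.
  have h : ∀ {k : ℕ} (r : Term S Θ' k), A.interp r = (A.elements _).interp
      (fun i => Pi.π (fun i : Fin Θ'.len => A.obj (Θ'.entry i)) i) r := by
    intro k r
    rw [← lift_interp, piLift_π, Category.id_comp]
  rw [h, AbstractClone.interp_cmp, lift_interp]
  congr 1; funext p
  exact (h _).symm

end

/-- A clone homomorphism commutes with the interpretation of terms. -/
theorem Hom.interp_app {A B : SigClone S C} (h : A ⟶ B) {Θ : NatSeq} {n : ℕ} (t : Term S Θ n) :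
    A.interp t ≫ h.app n = Limits.Pi.map (fun i => h.app (Θ.entry i)) ≫ B.interp t := by
  induction t with
  | var x => simp [interp, h.ι_app]
  | mvar i ts ih =>
    simp only [interp, Category.assoc, h.ς_app]
    simp only [← Category.assoc, prod.lift_map, prod.comp_lift, comp_piLift]
    congr 2
    · simp
    · ext j; simp [ih]
  | op ω ts ih =>
    simp only [interp, Category.assoc, h.opMap_app]
    simp only [← Category.assoc]
    congr 1
    ext j; simp [ih]

end SigClone

end SecondOrder

namespace SecondOrder

/-! ### Metavariable contexts indexed by finite types -/

section

variable {I : Type} [Fintype I]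

/-- The metavariable context with one metavariable of arity `a i` for each `i : I`. -/
noncomputable def NatSeq.ofFintype (a : I → ℕ) : NatSeq :=
  ⟨Fintype.card I, fun p => a ((Fintype.equivFin I).symm p)⟩

/-- The metavariables of `NatSeq.ofFintype a` are indexed by `I`. -/
noncomputable def NatSeq.index (a : I → ℕ) : Fin (NatSeq.ofFintype a).len ≃ I :=
  (Fintype.equivFin I).symm

/-- A family indexed by `I` as a family indexed by the metavariables of `NatSeq.ofFintype`. -/
noncomputable def NatSeq.reindex {Z : ℕ → Type*} {a : I → ℕ} (r : ∀ i, Z (a i))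
    (p : Fin (NatSeq.ofFintype a).len) : Z ((NatSeq.ofFintype a).entry p) :=
  r (NatSeq.index a p)

/-- The generic term of the metavariable indexed by `i`. -/
noncomputable def Term.gen (S : Signature.{u}) (a : I → ℕ) (i : I) :
    Term S (NatSeq.ofFintype a) (a i) :=
  (congrArg a ((NatSeq.index a).apply_symm_apply i)) ▸
    (Term.generic (S := S) (Θ := NatSeq.ofFintype a) ((NatSeq.index a).symm i))

/-- The transport in `Term.gen` disappears at an index of the form `NatSeq.index a p`. Every index
has this form, so arguments about `Term.gen` reduce to this case. -/
theorem Term.gen_index (S : Signature.{u}) (a : I → ℕ) (p : Fin (NatSeq.ofFintype a).len) :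
    Term.gen S a (NatSeq.index a p) = Term.generic p := by
  have h : ∀ q : Fin (NatSeq.ofFintype a).len, q = p →
      ∀ h' : a (NatSeq.index a q) = a (NatSeq.index a p),
      (h' ▸ (Term.generic (S := S) (Θ := NatSeq.ofFintype a) q) : Term S (NatSeq.ofFintype a)
        (a (NatSeq.index a p))) = Term.generic p := by
    rintro q rfl h'
    rfl
  exact h _ (by simp) _

theorem Term.gen_cmp {S : Signature.{u}} {a : I → ℕ} {Θ : NatSeq} (s : ∀ i, Term S Θ (a i))
    (i : I) : (Term.gen S a i).cmp (NatSeq.reindex s) = s i := by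
  obtain ⟨p, rfl⟩ := (NatSeq.index a).surjective i
  rw [Term.gen_index]
  exact Term.generic_cmp _ p

theorem AbstractClone.interp_gen {S : Signature.{u}} (A : AbstractClone.{u, v} S) {a : I → ℕ}
    (r : ∀ i, A.carrier (a i)) (i : I) :
    A.interp (NatSeq.reindex r) (Term.gen S a i) = r i := by
  obtain ⟨p, rfl⟩ := (NatSeq.index a).surjective i
  rw [Term.gen_index]
  exact A.interp_generic _ p

end

/-! ### Products in the classifying category -/

variable {E : Presentation.{u}}

theorem TermClass.cmp_generic {Θ Θ' : NatSeq} (m : ∀ p : Fin Θ.len, TermClass E Θ' (Θ.entry p))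
    (p : Fin Θ.len) : TermClass.cmp m (cls E (Term.generic p)) = m p := by
  obtain ⟨a, rfl⟩ := exists_rep m
  rw [TermClass.cmp_cls, Term.generic_cmp]

namespace Classifying

/-- The object `(n)`. -/
abbrev single (E : Presentation.{u}) (n : ℕ) : Classifying E := ⟨⟨1, fun _ => n⟩⟩

/-- A class of terms as a morphism. -/
def ofClass {X : Classifying E} {n : ℕ} (t : TermClass E X.seq n) : X ⟶ single E n :=
  fun _ => t

/-- The projections of a sequence onto its entries. -/
abbrev proj (X : Classifying E) (i : Fin X.seq.len) : X ⟶ single E (X.seq.entry i) :=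
  ofClass (cls E (Term.generic i))

theorem comp_proj {X Y : Classifying E} (f : X ⟶ Y) (i : Fin Y.seq.len) :
    f ≫ Y.proj i = ofClass (f i) :=
  funext fun _ => TermClass.cmp_generic f i

/-- Each object is the product of its entries. -/
noncomputable def isLimitProj (X : Classifying E) : IsLimit (Fan.mk X X.proj) :=
  Fan.IsLimit.mk _ (fun s i => s.proj i 0)
    (fun s i => by
      refine (comp_proj (Y := X) _ i).trans (funext fun j => ?_)
      rw [Subsingleton.elim j 0]
      rfl)
    (fun s m h => by
      funext i
      rw [← h i]
      exact (congrFun (comp_proj m i) 0).symm)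

variable {J : Type} [Fintype J]

/-- The arities of the entries of a finite family of sequences. -/
abbrev entries (f : J → Classifying E) (x : Σ j, Fin (f j).seq.len) : ℕ := (f x.1).seq.entry x.2

/-- The concatenation of a finite family of sequences. -/
noncomputable abbrev concat (f : J → Classifying E) : Classifying E :=
  ⟨NatSeq.ofFintype (entries f)⟩

/-- The projections of a concatenation. -/
noncomputable def concatProj (f : J → Classifying E) (j : J) : concat f ⟶ f j :=
  fun k => cls E (Term.gen E.sig (entries f) ⟨j, k⟩)

theorem concatProj_index (f : J → Classifying E) (p : Fin (concat f).seq.len) :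
    concatProj f (NatSeq.index (entries f) p).1 (NatSeq.index (entries f) p).2 =
      cls E (Term.generic p) :=
  congrArg (cls E) (Term.gen_index E.sig (entries f) p)

theorem comp_concatProj (f : J → Classifying E) {X : Classifying E} (m : X ⟶ concat f)
    (p : Fin (concat f).seq.len) :
    (m ≫ concatProj f (NatSeq.index (entries f) p).1) (NatSeq.index (entries f) p).2 = m p :=
  (congrArg (TermClass.cmp m) (concatProj_index f p)).trans (TermClass.cmp_generic m p)

/-- Concatenations are products. -/
noncomputable def isLimitConcat (f : J → Classifying E) :
    IsLimit (Fan.mk (concat f) (concatProj f)) :=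
  Fan.IsLimit.mk _ (fun s p => s.proj (NatSeq.index (entries f) p).1
      (NatSeq.index (entries f) p).2)
    (fun s j => by
      funext k
      -- Quantifying over the whole pair allows it to be replaced by the index of some `p`, where no
      -- transport is left.
      have h : ∀ x : Σ j, Fin (f j).seq.len, ((fun p => s.proj (NatSeq.index (entries f) p).1
            (NatSeq.index (entries f) p).2 : s.pt ⟶ concat f) ≫
          concatProj f x.1) x.2 = s.proj x.1 x.2 := by
        intro x
        obtain ⟨p, rfl⟩ := (NatSeq.index (entries f)).surjective x
        exact comp_concatProj f _ p
      exact h ⟨j, k⟩)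
    (fun s m h => by
      funext p
      rw [← h]
      exact (comp_concatProj f m p).symm)

end Classifying

/-! ### The functorial model of a clone -/

variable {C : Type w} [Category.{v} C] [HasFiniteProducts C]

/-- Soundness in $\mathcal C$: set-level soundness at the stage $\prod_i S_{m_i}$, evaluated at the
projections. -/
theorem SigClone.interp_eq_of_derivable {A : SigClone E.sig C} (hA : satisfiesAxioms E C A)
    {Θ : NatSeq} {n : ℕ} {s t : Term E.sig Θ n} (h : Derivable E s t) :
    A.interp s = A.interp t := by
  have key := h.interp_eq (A := A.elements (∏ᶜ fun i : Fin Θ.len => A.obj (Θ.entry i)))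
    (fun e he => AbstractClone.Valid.of_interp_extend _ (fun d ρ => by
      rw [← A.lift_interp, ← A.lift_interp, hA e he d]))
    (fun i => Pi.π _ i)
  rw [← A.lift_interp, ← A.lift_interp, SigClone.piLift_π, Category.id_comp, Category.id_comp]
    at key
  exact key

namespace EClone

/-- The interpretation of a class of terms. -/
noncomputable def interpClass (A : EClone E C) {Θ : NatSeq} {n : ℕ} (t : TermClass E Θ n) :
    (∏ᶜ fun i : Fin Θ.len => A.obj.obj (Θ.entry i)) ⟶ A.obj.obj n :=
  Quotient.lift (s := derivableSetoid E Θ n) A.obj.interp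
    (fun _ _ h => SigClone.interp_eq_of_derivable A.property h) t

/-- The functor on the classifying category that interprets terms in a clone. -/
noncomputable def model (A : EClone E C) : Classifying E ⥤ C where
  obj X := ∏ᶜ fun i : Fin X.seq.len => A.obj.obj (X.seq.entry i)
  map f := Pi.lift (fun i => A.interpClass (f i))
  map_id X := by
    ext i
    refine (Pi.lift_π _ i).trans ?_
    rw [Category.id_comp]
    exact A.obj.interp_generic i
  map_comp f g := by
    obtain ⟨a, rfl⟩ := exists_rep f
    obtain ⟨b, rfl⟩ := exists_rep g
    ext i
    rw [Pi.lift_π, Category.assoc, Pi.lift_π]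
    change A.interpClass (TermClass.cmp _ _) = _
    rw [TermClass.cmp_cls]
    exact A.obj.interp_cmp a (b i)

/-- The projections of the values of the model of a clone. -/
noncomputable def modelProj (A : EClone E C) (X : Classifying E) (i : Fin X.seq.len) :
    A.model.obj X ⟶ A.obj.obj (X.seq.entry i) :=
  Pi.π (fun i : Fin X.seq.len => A.obj.obj (X.seq.entry i)) i

/-- Tupling into the values of the model of a clone. -/
noncomputable def modelLift (A : EClone E C) (X : Classifying E) {Y : C}
    (r : ∀ i : Fin X.seq.len, Y ⟶ A.obj.obj (X.seq.entry i)) : Y ⟶ A.model.obj X :=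
  Pi.lift r

/-- The interpretation of a class of terms on the values of the model of a clone. -/
noncomputable def modelInterp (A : EClone E C) (X : Classifying E) {n : ℕ}
    (t : TermClass E X.seq n) : A.model.obj X ⟶ A.obj.obj n :=
  A.interpClass t

variable (A B : EClone E C) {X Y : Classifying E}

theorem modelLift_proj {Z : C} (r : ∀ i : Fin X.seq.len, Z ⟶ A.obj.obj (X.seq.entry i))
    (i : Fin X.seq.len) : A.modelLift X r ≫ A.modelProj X i = r i :=
  Pi.lift_π _ i

theorem model_hom_ext {Z : C} {f g : Z ⟶ A.model.obj X}
    (h : ∀ i, f ≫ A.modelProj X i = g ≫ A.modelProj X i) : f = g :=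
  Limits.Pi.hom_ext _ _ h

theorem model_map_proj (f : X ⟶ Y) (i : Fin Y.seq.len) :
    A.model.map f ≫ A.modelProj Y i = A.modelInterp X (f i) :=
  Pi.lift_π _ i

theorem modelInterp_generic (i : Fin X.seq.len) :
    A.modelInterp X (cls E (Term.generic i)) = A.modelProj X i :=
  A.obj.interp_generic i

theorem modelLift_interp {Θ : NatSeq} {Z : C} (r : ∀ i : Fin Θ.len, Z ⟶ A.obj.obj (Θ.entry i))
    {n : ℕ} (t : Term E.sig Θ n) :
    A.modelLift ⟨Θ⟩ r ≫ A.modelInterp ⟨Θ⟩ (cls E t) = (A.obj.elements Z).interp r t :=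
  A.obj.lift_interp r t

variable {J : Type} [Fintype J]

theorem comp_model_concatProj (f : J → Classifying E) {Z : C}
    (m : Z ⟶ A.model.obj (Classifying.concat f)) (p : Fin (Classifying.concat f).seq.len) :
    (m ≫ A.model.map (Classifying.concatProj f
        (NatSeq.index (Classifying.entries f) p).1)) ≫
      A.modelProj _ (NatSeq.index (Classifying.entries f) p).2 = m ≫ A.modelProj _ p := by
  rw [Category.assoc, model_map_proj]
  congr 1
  exact (congrArg (A.modelInterp _) (Classifying.concatProj_index f p)).trans
    (A.modelInterp_generic p)

/-- The model of a clone sends concatenations to products. -/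
noncomputable def isLimitModelConcat (f : J → Classifying E) :
    IsLimit (Fan.mk (A.model.obj (Classifying.concat f))
      (fun j => A.model.map (Classifying.concatProj f j)) : Fan fun j => A.model.obj (f j)) :=
  Fan.IsLimit.mk _ (fun s => A.modelLift _ (fun p =>
      s.proj (NatSeq.index (Classifying.entries f) p).1 ≫
        A.modelProj _ (NatSeq.index (Classifying.entries f) p).2))
    (fun s j => by
      refine A.model_hom_ext (fun k => ?_)
      have h : ∀ x : Σ j, Fin (f j).seq.len,
          (A.modelLift (Classifying.concat f) (fun p =>
            s.proj (NatSeq.index (Classifying.entries f) p).1 ≫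
              A.modelProj _ (NatSeq.index (Classifying.entries f) p).2) ≫
            A.model.map (Classifying.concatProj f x.1)) ≫ A.modelProj _ x.2 =
            s.proj x.1 ≫ A.modelProj _ x.2 := by
        intro x
        obtain ⟨p, rfl⟩ := (NatSeq.index (Classifying.entries f)).surjective x
        exact (A.comp_model_concatProj f _ p).trans (A.modelLift_proj (X := Classifying.concat f) _ p)
      exact h ⟨j, k⟩)
    (fun s m h => by
      refine A.model_hom_ext (X := Classifying.concat f) (fun p => ?_)
      refine Eq.trans ?_ (A.modelLift_proj (X := Classifying.concat f) _ p).symm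
      rw [← h]
      exact (A.comp_model_concatProj f m p).symm)

/-- One limit cone per finite family suffices. Concatenation provides it, and its image is a product
cone because a product of products is a product over the disjoint union of the index sets. -/
theorem preservesFiniteProducts_model : PreservesFiniteProducts A.model where
  preserves n := ⟨fun {K} => by
    have : PreservesLimit (Discrete.functor (K.obj ∘ Discrete.mk)) A.model :=
      preservesLimit_of_preserves_limit_cone (Classifying.isLimitConcat _)
        ((isLimitMapConeFanMkEquiv _ _ _).symm (A.isLimitModelConcat _))
    exact preservesLimit_of_iso_diagram A.model Discrete.natIsoFunctor.symm⟩

variable {A B} in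
/-- The natural transformation induced by a clone homomorphism. -/
noncomputable def modelMap (h : A.obj ⟶ B.obj) : A.model ⟶ B.model where
  app X := B.modelLift X (fun i => A.modelProj X i ≫ h.app (X.seq.entry i))
  naturality X Y f := by
    obtain ⟨a, rfl⟩ := exists_rep f
    refine B.model_hom_ext (fun i => ?_)
    rw [Category.assoc, Category.assoc, modelLift_proj, ← Category.assoc, model_map_proj,
      model_map_proj]
    -- Naturality at a class of terms says that homomorphisms commute with the interpretation of a
    -- representative.
    refine (h.interp_app (a i)).trans ?_
    congr 1

variable {A B} in
theorem modelMap_app_proj (h : A.obj ⟶ B.obj) (i : Fin X.seq.len) :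
    (modelMap h).app X ≫ B.modelProj X i = A.modelProj X i ≫ h.app (X.seq.entry i) :=
  B.modelLift_proj _ i

end EClone

/-- The functor from clones to functorial models. -/
noncomputable def modelFunctor (E : Presentation.{u}) (C : Type w) [Category.{v} C]
    [HasFiniteProducts C] : EClone E C ⥤ FMod (theoryOf E) C where
  obj A := ⟨A.model, A.preservesFiniteProducts_model⟩
  map h := ObjectProperty.homMk (EClone.modelMap h.hom)
  map_id A := by
    apply ObjectProperty.hom_ext
    apply NatTrans.ext
    funext X
    refine A.model_hom_ext (fun i => ?_)
    refine (EClone.modelMap_app_proj _ i).trans ?_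
    exact (Category.comp_id _).trans (Category.id_comp _).symm
  map_comp {A B D} f g := by
    apply ObjectProperty.hom_ext
    apply NatTrans.ext
    funext X
    refine D.model_hom_ext (fun i => ?_)
    refine (EClone.modelMap_app_proj _ i).trans ?_
    change A.modelProj X i ≫ f.hom.app _ ≫ g.hom.app _ =
      ((EClone.modelMap f.hom).app X ≫ (EClone.modelMap g.hom).app X) ≫ D.modelProj X i
    rw [Category.assoc, EClone.modelMap_app_proj, ← Category.assoc, ← Category.assoc,
      EClone.modelMap_app_proj]

end SecondOrder

namespace SecondOrder

/-! ### Generic substitution and operator terms -/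

/-- The arities of one metavariable in context `m` and of `m` metavariables in context `n`. -/
def substArity (m n : ℕ) : Option (Fin m) → ℕ
  | none => m
  | some _ => n

/-- A family indexed by the metavariables of the generic substitution. -/
def substFamily {Z : ℕ → Type*} {m n : ℕ} (t : Z m) (a : Fin m → Z n) : ∀ i, Z (substArity m n i)
  | none => t
  | some i => a i

/-- The generic instance of substitution. -/
noncomputable def Term.genericSubst (S : Signature.{u}) (m n : ℕ) :
    Term S (NatSeq.ofFintype (substArity m n)) n :=
  Term.subst (fun j => Term.gen S (substArity m n) (some j)) (Term.gen S (substArity m n) none)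

/-- The metavariable context of the generic instance of an operator. -/
def Signature.opCtx (S : Signature.{u}) (ω : S.Op) (n : ℕ) : NatSeq :=
  ⟨(S.arity ω).len, fun i => n + (S.arity ω).entry i⟩

/-- The generic instance of an operator. -/
def Term.genericOp (S : Signature.{u}) (ω : S.Op) (n : ℕ) : Term S (S.opCtx ω n) n :=
  .op ω (fun i => Term.generic (Θ := S.opCtx ω n) i)

namespace AbstractClone

variable {S : Signature.{u}} (A : AbstractClone.{u, v} S) {Θ : NatSeq}

theorem interp_subst {m n : ℕ} (ρ : ∀ i : Fin Θ.len, A.carrier (Θ.entry i)) (t : Term S Θ m)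
    (σ : Fin m → Term S Θ n) :
    A.interp ρ (t.subst σ) = A.sub (A.interp ρ t) (fun i => A.interp ρ (σ i)) := by
  simp only [interp_eq_eval, eval_subst, sub_eval, act_sub, var_sub]
  congr 1; funext p
  unfold act
  congr 1; funext x; simp

/-- Substitution is the interpretation of one term, hence comes from a morphism of $\mathbb
M(\mathcal E)$; natural transformations must therefore respect it. -/
theorem interp_genericSubst {m n : ℕ} (t : A.carrier m) (a : Fin m → A.carrier n) :
    A.interp (NatSeq.reindex (substFamily t a)) (Term.genericSubst S m n) = A.sub t a := by
  refine (A.interp_subst _ _ _).trans ?_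
  exact congrArg₂ A.sub (A.interp_gen (substFamily t a) none)
    (funext fun i => A.interp_gen (substFamily t a) (some i))

theorem interp_genericOp (ω : S.Op) {n : ℕ}
    (ts : ∀ i : Fin (S.arity ω).len, A.carrier (n + (S.arity ω).entry i)) :
    A.interp (Θ := S.opCtx ω n) ts (Term.genericOp S ω n) = A.op ω ts :=
  congrArg (A.op ω) (funext fun i => A.interp_generic (Θ := S.opCtx ω n) ts i)

end AbstractClone

/-! ### Full faithfulness -/

variable {E : Presentation.{u}} {C : Type w} [Category.{v} C] [HasFiniteProducts C]

namespace EClone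

variable {A B : EClone E C}

/-- The components of a natural transformation at the objects `(n)`. -/
noncomputable def component (α : A.model ⟶ B.model) (n : ℕ) : A.obj.obj n ⟶ B.obj.obj n :=
  A.modelLift (Classifying.single E n) (fun _ => 𝟙 _) ≫ α.app (Classifying.single E n) ≫
    B.modelProj (Classifying.single E n) (0 : Fin 1)

/-- Naturality of `α` at the class `t`, seen as a morphism into $(n)$. -/
theorem app_modelInterp (α : A.model ⟶ B.model) {X : Classifying E} {n : ℕ}
    (t : TermClass E X.seq n) :
    α.app X ≫ B.modelInterp X t = A.modelInterp X t ≫ component α n := by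
  have h : A.model.map (Classifying.ofClass t) =
      A.modelInterp X t ≫ A.modelLift (Classifying.single E n) (fun _ => 𝟙 _) := by
    refine A.model_hom_ext (fun i => ?_)
    rw [Category.assoc, modelLift_proj, model_map_proj]
    exact (Category.comp_id _).symm
  have h' := B.model_map_proj (Classifying.ofClass t) (0 : Fin 1)
  change _ = B.modelInterp X t at h'
  rw [← h', ← Category.assoc, ← α.naturality, h]
  simp only [component, Category.assoc]

theorem app_proj (α : A.model ⟶ B.model) {X : Classifying E} (i : Fin X.seq.len) :
    α.app X ≫ B.modelProj X i = A.modelProj X i ≫ component α (X.seq.entry i) := by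
  rw [← modelInterp_generic, ← modelInterp_generic, app_modelInterp]

theorem interp_component (α : A.model ⟶ B.model) {Z : C} {Θ : NatSeq} {n : ℕ}
    (ρ : ∀ i : Fin Θ.len, Z ⟶ A.obj.obj (Θ.entry i)) (t : Term E.sig Θ n) :
    (A.obj.elements Z).interp ρ t ≫ component α n =
      (B.obj.elements Z).interp (fun i => ρ i ≫ component α (Θ.entry i)) t := by
  rw [← modelLift_interp, ← modelLift_interp, Category.assoc, ← app_modelInterp, ← Category.assoc]
  congr 1
  refine B.model_hom_ext (fun i => ?_)
  rw [Category.assoc, app_proj, ← Category.assoc, modelLift_proj, modelLift_proj]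

theorem evar_component (α : A.model ⟶ B.model) (Z : C) {n : ℕ} (i : Fin n) :
    A.obj.evar Z i ≫ component α n = B.obj.evar Z i :=
  (interp_component (Θ := ⟨0, Fin.elim0⟩) α (fun i => i.elim0) (.var i))

theorem esub_component (α : A.model ⟶ B.model) {Z : C} {m n : ℕ} (t : Z ⟶ A.obj.obj m)
    (a : Fin m → (Z ⟶ A.obj.obj n)) :
    A.obj.esub t a ≫ component α n =
      B.obj.esub (t ≫ component α m) (fun i => a i ≫ component α n) := by
  refine (congrArg (· ≫ component α n)
    ((A.obj.elements Z).interp_genericSubst t a).symm).trans ?_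
  refine (interp_component α _ _).trans ?_
  refine Eq.trans ?_ ((B.obj.elements Z).interp_genericSubst _ _)
  congr 1; funext p
  unfold NatSeq.reindex
  have h : ∀ x : Option (Fin m), substFamily (Z := fun n => Z ⟶ A.obj.obj n) t a x ≫
      component α (substArity m n x) = substFamily (Z := fun n => Z ⟶ B.obj.obj n)
        (t ≫ component α m) (fun i => a i ≫ component α n) x := by
    rintro (_ | x) <;> rfl
  exact h _

theorem eop_component (α : A.model ⟶ B.model) {Z : C} (ω : E.sig.Op) {n : ℕ}
    (ts : ∀ i : Fin (E.sig.arity ω).len, Z ⟶ A.obj.obj (n + (E.sig.arity ω).entry i)) :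
    A.obj.eop ω ts ≫ component α n = B.obj.eop ω (fun i => ts i ≫ component α _) := by
  refine (congrArg (· ≫ component α n)
    ((A.obj.elements Z).interp_genericOp ω ts).symm).trans ?_
  exact (interp_component α _ _).trans ((B.obj.elements Z).interp_genericOp ω _)

/-- The clone homomorphism underlying a natural transformation of models. -/
noncomputable def homOfModelMap (α : A.model ⟶ B.model) : A.obj ⟶ B.obj where
  app := component α
  ι_app n i := by
    have h := evar_component α (⊤_ C) i
    have e : terminal.from (⊤_ C) = 𝟙 _ := Subsingleton.elim _ _
    simpa [SigClone.evar, e] using h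
  ς_app m n := by
    -- The universal case: the generalized elements are the projections of $S_m\times S_n^m$.
    have h := esub_component α (prod.fst : A.obj.obj m ⨯ (∏ᶜ fun _ : Fin m => A.obj.obj n) ⟶ _)
      (fun i => prod.snd ≫ Pi.π _ i)
    simp only [SigClone.esub, ← SigClone.comp_piLift, SigClone.piLift_π, Category.comp_id,
      prod.lift_fst_snd, Category.id_comp] at h
    rw [h]
    congr 1
    ext i <;> simp [prod.lift_fst, prod.lift_snd_assoc]
  opMap_app ω n := by
    have h := eop_component α ω (fun i => Pi.π (fun i : Fin (E.sig.arity ω).len =>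
      A.obj.obj (n + (E.sig.arity ω).entry i)) i)
    simp only [SigClone.eop, SigClone.piLift_π, Category.id_comp] at h
    rw [h]
    congr 1

end EClone

/-- A homomorphism is read off from its natural transformation at the objects $(n)$, whose values
are one-fold products of $S_n$. -/
instance : (modelFunctor E C).Faithful where
  map_injective {A B f g} h := by
    apply ObjectProperty.hom_ext
    apply SigClone.Hom.ext
    funext n
    have h' : EClone.modelMap f.hom = EClone.modelMap g.hom :=
      congrArg (fun k : (modelFunctor E C).obj A ⟶ (modelFunctor E C).obj B => k.hom) h
    have key := (EClone.modelMap_app_proj f.hom (X := Classifying.single E n) 0).symm.trans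
      ((congrArg (fun α => NatTrans.app α _ ≫ B.modelProj _ 0) h').trans
        (EClone.modelMap_app_proj g.hom (X := Classifying.single E n) 0))
    have := congrArg (fun k => A.modelLift (Classifying.single E n)
      (fun _ => 𝟙 (A.obj.obj n)) ≫ k) key
    simp only [← Category.assoc, EClone.modelLift_proj] at this
    exact (Category.id_comp _).symm.trans (this.trans (Category.id_comp _))

/-- By `EClone.app_proj`, a natural transformation acts on each factor by its component there,
exactly as the transformation induced by `EClone.homOfModelMap` does. -/
instance : (modelFunctor E C).Full where
  map_surjective {A B} α := by
    refine ⟨ObjectProperty.homMk (EClone.homOfModelMap α.hom), ?_⟩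
    apply ObjectProperty.hom_ext
    apply NatTrans.ext
    funext X
    refine B.model_hom_ext (fun i => ?_)
    exact (EClone.modelMap_app_proj _ i).trans (EClone.app_proj α.hom i).symm

end SecondOrder

namespace SecondOrder

/-! ### The clone of a functorial model -/

namespace Term

variable {S : Signature.{u}} {Θ Θ' : NatSeq}

/-- The terms replacing the metavariables contain no ambient variables, so the substitution leaves
them unchanged. -/
theorem subst_cmp {m n : ℕ} (t : Term S Θ m) (σ : Fin m → Term S Θ n)
    (s : ∀ p : Fin Θ.len, Term S Θ' (Θ.entry p)) :
    (t.subst σ).cmp s = (t.cmp s).subst (fun i => (σ i).cmp s) := by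
  unfold cmp
  rw [← subst_msub]
  intro p
  rw [subst_ren, ren_eq_subst]
  congr 1; funext x; simp

theorem genericSubst_cmp {m n : ℕ} (t : Term S Θ m) (σ : Fin m → Term S Θ n) :
    (genericSubst S m n).cmp (NatSeq.reindex (substFamily t σ)) = t.subst σ := by
  refine (subst_cmp _ _ _).trans ?_
  exact congrArg₂ (fun r τ => subst τ r) (gen_cmp (substFamily t σ) none)
    (funext fun i => gen_cmp (substFamily t σ) (some i))

theorem genericOp_cmp (ω : S.Op) {n : ℕ}
    (ts : ∀ i : Fin (S.arity ω).len, Term S Θ (n + (S.arity ω).entry i)) :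
    (genericOp S ω n).cmp (Θ := S.opCtx ω n) ts = .op ω ts := by
  refine congrArg (Term.op ω) (funext fun i => ?_)
  refine Eq.trans ?_ (generic_cmp (Θ := S.opCtx ω n) ts i)
  unfold cmp
  congr 1; funext p
  exact (ren_ren (ts p) _ _).trans (congrArg (fun f => (ts p).ren f) (funext fun x => up_natAdd _ _ x))

end Term

namespace Model

variable {E : Presentation.{u}} {C : Type w} [Category.{v} C]

section

variable (F : Classifying E ⥤ C) [PreservesFiniteProducts F]

/-- The values of a cartesian functor are products. -/
noncomputable def isLimitMapProj (X : Classifying E) :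
    IsLimit (Fan.mk (F.obj X) (fun i => F.map (X.proj i)) :
      Fan fun i => F.obj (Classifying.single E (X.seq.entry i))) :=
  isLimitFanMkObjOfIsLimit F _ _ X.isLimitProj

/-- Tupling into the values of a cartesian functor. -/
noncomputable def tuple (X : Classifying E) {Y : C}
    (ρ : ∀ i : Fin X.seq.len, Y ⟶ F.obj (Classifying.single E (X.seq.entry i))) : Y ⟶ F.obj X :=
  Fan.IsLimit.lift (isLimitMapProj F X) ρ

theorem tuple_proj (X : Classifying E) {Y : C}
    (ρ : ∀ i : Fin X.seq.len, Y ⟶ F.obj (Classifying.single E (X.seq.entry i)))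
    (i : Fin X.seq.len) : tuple F X ρ ≫ F.map (X.proj i) = ρ i :=
  Fan.IsLimit.fac (isLimitMapProj F X) ρ i

theorem obj_hom_ext {X : Classifying E} {Y : C} {f g : Y ⟶ F.obj X}
    (h : ∀ i, f ≫ F.map (X.proj i) = g ≫ F.map (X.proj i)) : f = g :=
  Fan.IsLimit.hom_ext (isLimitMapProj F X) f g h

variable {Θ Θ' : NatSeq} {Y Z : C}

/-- The value of a term at generalized elements of a functorial model. -/
noncomputable def value (ρ : ∀ i : Fin Θ.len, Y ⟶ F.obj (Classifying.single E (Θ.entry i)))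
    {n : ℕ} (t : Term E.sig Θ n) : Y ⟶ F.obj (Classifying.single E n) :=
  tuple F ⟨Θ⟩ ρ ≫ F.map (Classifying.ofClass (X := ⟨Θ⟩) (cls E t))

theorem comp_tuple (X : Classifying E)
    (ρ : ∀ i : Fin X.seq.len, Y ⟶ F.obj (Classifying.single E (X.seq.entry i))) (g : Z ⟶ Y) :
    g ≫ tuple F X ρ = tuple F X (fun i => g ≫ ρ i) :=
  obj_hom_ext F (fun i => by rw [Category.assoc, tuple_proj, tuple_proj])

theorem comp_value (ρ : ∀ i : Fin Θ.len, Y ⟶ F.obj (Classifying.single E (Θ.entry i)))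
    {n : ℕ} (t : Term E.sig Θ n) (g : Z ⟶ Y) :
    g ≫ value F ρ t = value F (fun i => g ≫ ρ i) t := by
  rw [value, ← Category.assoc, comp_tuple]
  rfl

theorem value_generic (ρ : ∀ i : Fin Θ.len, Y ⟶ F.obj (Classifying.single E (Θ.entry i)))
    (i : Fin Θ.len) : value F ρ (Term.generic i) = ρ i :=
  tuple_proj F ⟨Θ⟩ ρ i

/-- Functoriality of `F`, as composition in $\mathbb M(\mathcal E)$ is metasubstitution. -/
theorem value_cmp (ρ : ∀ i : Fin Θ'.len, Y ⟶ F.obj (Classifying.single E (Θ'.entry i)))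
    (s : ∀ p : Fin Θ.len, Term E.sig Θ' (Θ.entry p)) {n : ℕ} (t : Term E.sig Θ n) :
    value F ρ (t.cmp s) = value F (fun p => value F ρ (s p)) t := by
  let f : (⟨Θ'⟩ : Classifying E) ⟶ ⟨Θ⟩ := fun p => cls E (s p)
  have h : (Classifying.ofClass (X := ⟨Θ'⟩) (cls E (t.cmp s))) =
      f ≫ Classifying.ofClass (X := ⟨Θ⟩) (cls E t) :=
    funext fun _ => (TermClass.cmp_cls s t).symm
  have h' : tuple F ⟨Θ'⟩ ρ ≫ F.map f = tuple F ⟨Θ⟩ (fun p => value F ρ (s p)) := by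
    refine obj_hom_ext F (fun i => ?_)
    rw [tuple_proj, Category.assoc, ← F.map_comp, Classifying.comp_proj]
    rfl
  rw [value, h, F.map_comp, ← Category.assoc, h']
  rfl

theorem value_eq_of_derivable
    (ρ : ∀ i : Fin Θ.len, Y ⟶ F.obj (Classifying.single E (Θ.entry i)))
    {n : ℕ} {s t : Term E.sig Θ n} (h : Derivable E s t) : value F ρ s = value F ρ t := by
  have e : cls E s = cls E t := Quotient.sound (s := derivableSetoid E Θ n) h
  rw [value, e, value]

theorem value_gen {I : Type} [Fintype I] {a : I → ℕ}
    (r : ∀ i, Y ⟶ F.obj (Classifying.single E (a i))) (i : I) :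
    value F (NatSeq.reindex (Z := fun n => Y ⟶ F.obj (Classifying.single E n)) r)
      (Term.gen E.sig a i) = r i := by
  obtain ⟨p, rfl⟩ := (NatSeq.index a).surjective i
  rw [Term.gen_index]
  exact value_generic F _ p

/-- A finite family of generalized elements consists of the values of terms at common
arguments. -/
theorem exists_eq_value {I : Type} [Fintype I] {a : I → ℕ}
    (r : ∀ i, Y ⟶ F.obj (Classifying.single E (a i))) :
    ∃ (Θ : NatSeq) (ρ : ∀ i : Fin Θ.len, Y ⟶ F.obj (Classifying.single E (Θ.entry i)))
      (q : ∀ i, Term E.sig Θ (a i)), ∀ i, r i = value F ρ (q i) :=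
  ⟨_, _, _, fun i => (value_gen F r i).symm⟩

/-- The variables of a functorial model. -/
noncomputable def var (Y : C) {n : ℕ} (i : Fin n) : Y ⟶ F.obj (Classifying.single E n) :=
  value F (Θ := ⟨0, Fin.elim0⟩) (fun i => i.elim0) (.var i)

/-- Substitution in a functorial model. -/
noncomputable def sub {m n : ℕ} (t : Y ⟶ F.obj (Classifying.single E m))
    (a : Fin m → (Y ⟶ F.obj (Classifying.single E n))) : Y ⟶ F.obj (Classifying.single E n) :=
  value F (NatSeq.reindex (Z := fun n => Y ⟶ F.obj (Classifying.single E n))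
      (substFamily (Z := fun n => Y ⟶ F.obj (Classifying.single E n)) t a))
    (Term.genericSubst E.sig m n)

/-- The operators in a functorial model. -/
noncomputable def op (ω : E.sig.Op) {n : ℕ}
    (ts : ∀ i : Fin (E.sig.arity ω).len,
      Y ⟶ F.obj (Classifying.single E (n + (E.sig.arity ω).entry i))) :
    Y ⟶ F.obj (Classifying.single E n) :=
  value F (Θ := E.sig.opCtx ω n) ts (Term.genericOp E.sig ω n)

theorem comp_var (g : Z ⟶ Y) {n : ℕ} (i : Fin n) : g ≫ var F Y i = var F Z i := by
  rw [var, comp_value, var]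
  congr 1; funext i; exact i.elim0

theorem comp_sub (g : Z ⟶ Y) {m n : ℕ} (t : Y ⟶ F.obj (Classifying.single E m))
    (a : Fin m → (Y ⟶ F.obj (Classifying.single E n))) :
    g ≫ sub F t a = sub F (g ≫ t) (fun i => g ≫ a i) := by
  rw [sub, comp_value, sub]
  congr 1; funext p
  have h : ∀ x, g ≫ substFamily (Z := fun n => Y ⟶ F.obj (Classifying.single E n)) t a x =
      substFamily (Z := fun n => Z ⟶ F.obj (Classifying.single E n)) (g ≫ t)
        (fun i => g ≫ a i) x := by
    rintro (_ | x) <;> rfl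
  exact h _

theorem comp_op (g : Z ⟶ Y) (ω : E.sig.Op) {n : ℕ}
    (ts : ∀ i : Fin (E.sig.arity ω).len,
      Y ⟶ F.obj (Classifying.single E (n + (E.sig.arity ω).entry i))) :
    g ≫ op F ω ts = op F ω (fun i => g ≫ ts i) :=
  comp_value F (Θ := E.sig.opCtx ω n) ts _ g

variable (ρ : ∀ i : Fin Θ.len, Y ⟶ F.obj (Classifying.single E (Θ.entry i)))

theorem value_var {n : ℕ} (i : Fin n) : value F ρ (.var i) = var F Y i := by
  have h := value_cmp F (Θ := ⟨0, Fin.elim0⟩) ρ (fun i => i.elim0) (.var i)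
  refine Eq.trans h ?_
  unfold var
  congr 1; funext i; exact i.elim0

/-- Every substitution is a metasubstitution instance of the generic one, so `value_cmp` applies. -/
theorem value_subst {m n : ℕ} (t : Term E.sig Θ m) (σ : Fin m → Term E.sig Θ n) :
    value F ρ (t.subst σ) = sub F (value F ρ t) (fun i => value F ρ (σ i)) := by
  rw [← Term.genericSubst_cmp, value_cmp, sub]
  congr 1; funext p
  have h : ∀ x, value F ρ (substFamily t σ x) =
      substFamily (Z := fun n => Y ⟶ F.obj (Classifying.single E n)) (value F ρ t)
        (fun i => value F ρ (σ i)) x := by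
    rintro (_ | x) <;> rfl
  exact h _

theorem value_op (ω : E.sig.Op) {n : ℕ}
    (ts : ∀ i : Fin (E.sig.arity ω).len, Term E.sig Θ (n + (E.sig.arity ω).entry i)) :
    value F ρ (.op ω ts) = op F ω (fun i => value F ρ (ts i)) := by
  rw [← Term.genericOp_cmp]
  exact value_cmp F (Θ := E.sig.opCtx ω n) ρ ts _

/-- This and the next three laws hold because the elements can be written as values of terms, for
which the law is an identity of the substitution calculus. -/
theorem sub_var {n : ℕ} (t : Y ⟶ F.obj (Classifying.single E n)) : sub F t (var F Y) = t := by
  obtain ⟨Θ, ρ, q, h⟩ := exists_eq_value F (I := Unit) (a := fun _ => n) (fun _ => t)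
  have hv : var F Y = fun i : Fin n => value F ρ (.var i) := funext fun i => (value_var F ρ i).symm
  rw [hv, h (), ← value_subst]
  exact congrArg _ (Term.subst_var _)

theorem var_sub {m n : ℕ} (i : Fin m) (a : Fin m → (Y ⟶ F.obj (Classifying.single E n))) :
    sub F (var F Y i) a = a i := by
  obtain ⟨Θ, ρ, q, h⟩ := exists_eq_value F a
  rw [← value_var F ρ, funext h, ← value_subst]
  rfl

theorem sub_sub {l m n : ℕ} (t : Y ⟶ F.obj (Classifying.single E l))
    (a : Fin l → (Y ⟶ F.obj (Classifying.single E m)))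
    (b : Fin m → (Y ⟶ F.obj (Classifying.single E n))) :
    sub F (sub F t a) b = sub F t (fun i => sub F (a i) b) := by
  -- All elements are represented at once, so that the terms share one metavariable context and can
  -- be substituted into each other.
  obtain ⟨Θ, ρ, q, h⟩ := exists_eq_value F (I := Unit ⊕ Fin l ⊕ Fin m)
    (a := Sum.elim (fun _ => l) (Sum.elim (fun _ => m) (fun _ => n)))
    (Sum.rec (fun _ => t) (Sum.rec a b))
  have ht : t = value F ρ (q (Sum.inl ())) := h (Sum.inl ())
  have ha : a = fun i => value F ρ (q (Sum.inr (Sum.inl i))) :=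
    funext fun i => h (Sum.inr (Sum.inl i))
  have hb : b = fun i => value F ρ (q (Sum.inr (Sum.inr i))) :=
    funext fun i => h (Sum.inr (Sum.inr i))
  rw [ht, ha, hb]
  refine (congrArg (fun x => sub F x _) (value_subst F ρ _ _).symm).trans ?_
  refine (value_subst F ρ _ _).symm.trans ?_
  refine (congrArg (value F ρ) (Term.subst_subst _ _ _)).trans ?_
  refine (value_subst F ρ _ _).trans ?_
  exact congrArg (sub F _) (funext fun i => value_subst F ρ _ _)

theorem op_sub (ω : E.sig.Op) {n m : ℕ}
    (ts : ∀ i : Fin (E.sig.arity ω).len,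
      Y ⟶ F.obj (Classifying.single E (n + (E.sig.arity ω).entry i)))
    (b : Fin n → (Y ⟶ F.obj (Classifying.single E m))) :
    sub F (op F ω ts) b = op F ω (fun i => sub F (ts i)
      (Fin.append
        (fun x => sub F (b x) (fun y => var F Y (Fin.castAdd ((E.sig.arity ω).entry i) y)))
        (fun z => var F Y (Fin.natAdd m z)))) := by
  obtain ⟨Θ, ρ, q, r, rfl, rfl⟩ : ∃ (Θ : NatSeq)
      (ρ : ∀ i : Fin Θ.len, Y ⟶ F.obj (Classifying.single E (Θ.entry i)))
      (q : ∀ i, Term E.sig Θ (n + (E.sig.arity ω).entry i)) (r : Fin n → Term E.sig Θ m),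
      ts = (fun i => value F ρ (q i)) ∧ b = fun i => value F ρ (r i) := by
    obtain ⟨Θ, ρ, q, h⟩ := exists_eq_value F (I := Fin (E.sig.arity ω).len ⊕ Fin n)
      (a := Sum.elim (fun i => n + (E.sig.arity ω).entry i) (fun _ => m)) (Sum.rec ts b)
    exact ⟨Θ, ρ, fun i => q (Sum.inl i), fun i => q (Sum.inr i),
      funext fun i => h (Sum.inl i), funext fun i => h (Sum.inr i)⟩
  refine (congrArg (fun x => sub F x _) (value_op F ρ ω _).symm).trans ?_
  refine (value_subst F ρ _ _).symm.trans ?_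
  refine (value_op F ρ ω _).trans ?_
  refine congrArg (op F ω) (funext fun i => ?_)
  refine (value_subst F ρ _ _).trans ?_
  refine congrArg (sub F _) (funext fun x => ?_)
  induction x using Fin.addCases with
  | left x =>
    rw [Term.lift_castAdd, Fin.append_left, Term.ren_eq_subst, value_subst]
    exact congrArg (sub F _) (funext fun y => value_var F ρ _)
  | right x => rw [Term.lift_natAdd, Fin.append_right, value_var]

end

variable [HasFiniteProducts C] (F : Classifying E ⥤ C) [PreservesFiniteProducts F]

variable {Y Z : C}

/-- The substitution morphisms of a functorial model. -/
noncomputable def genericSub (m n : ℕ) :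
    F.obj (Classifying.single E m) ⨯ (∏ᶜ fun _ : Fin m => F.obj (Classifying.single E n)) ⟶
      F.obj (Classifying.single E n) :=
  sub F prod.fst
    (fun j => prod.snd ≫ Pi.π (fun _ : Fin m => F.obj (Classifying.single E n)) j)

theorem lift_genericSub {m n : ℕ} (t : Y ⟶ F.obj (Classifying.single E m))
    (a : Y ⟶ ∏ᶜ fun _ : Fin m => F.obj (Classifying.single E n)) :
    prod.lift t a ≫ genericSub F m n = sub F t (fun j => a ≫ Pi.π _ j) := by
  rw [genericSub, comp_sub]
  simp only [prod.lift_fst, prod.lift_snd_assoc]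

theorem map_genericSub {m n : ℕ} (f : Y ⟶ F.obj (Classifying.single E m))
    (g : Z ⟶ ∏ᶜ fun _ : Fin m => F.obj (Classifying.single E n)) :
    prod.map f g ≫ genericSub F m n =
      sub F (prod.fst ≫ f) (fun j => prod.snd ≫ g ≫ Pi.π _ j) := by
  rw [← prod.lift_fst_comp_snd_comp, lift_genericSub]
  simp only [Category.assoc]

/-- The clone underlying a functorial model, without operators. -/
noncomputable def baseClone : Clone C where
  obj n := F.obj (Classifying.single E n)
  ι _ i := var F (⊤_ C) i
  ς := genericSub F
  ς_ι n := by
    rw [map_genericSub]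
    simp only [Pi.lift_π, comp_var, Category.comp_id]
    exact sub_var F _
  ι_ς m n i := by
    rw [map_genericSub, comp_var, var_sub, Category.id_comp]
  ς_ς l m n := by
    rw [prod.associator_inv, prod.lift_map_assoc, lift_genericSub, lift_genericSub, map_genericSub,
      sub_sub, Category.comp_id, Category.comp_id]
    refine congrArg (sub F _) (funext fun i => ?_)
    rw [Pi.lift_π, map_genericSub, comp_sub]
    simp only [Category.assoc, Category.id_comp]

theorem act_eq {m n : ℕ} (f : Fin m → Fin n) :
    (baseClone F).act f = sub F (𝟙 _) (fun i => var F _ (f i)) := by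
  refine (lift_genericSub F _ _).trans (congrArg (sub F _) (funext fun i => ?_))
  refine (Category.assoc _ _ _).trans ?_
  refine (congrArg (_ ≫ ·) (Pi.lift_π _ i)).trans ?_
  exact comp_var F _ _

theorem comp_act {m n : ℕ} (t : Y ⟶ F.obj (Classifying.single E m)) (f : Fin m → Fin n) :
    t ≫ (baseClone F).act f = sub F t (fun i => var F Y (f i)) := by
  refine (congrArg (t ≫ ·) (act_eq F f)).trans ((comp_sub F t _ _).trans ?_)
  simp only [comp_var, Category.comp_id]

theorem υ_π (m n k : ℕ) (x : Fin (n + k)) :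
    (baseClone F).υ m n k ≫ Pi.π _ x = Fin.append
      (fun x => sub F (Pi.π (fun _ : Fin n => F.obj (Classifying.single E m)) x)
        (fun y => var F _ (Fin.castAdd k y)))
      (fun z => var F _ (Fin.natAdd m z)) x := by
  refine (Pi.lift_π _ x).trans ?_
  induction x using Fin.addCases with
  | left x =>
    rw [Fin.append_left, Fin.append_left]
    exact comp_act F _ _
  | right x =>
    rw [Fin.append_right, Fin.append_right]
    exact comp_var F _ _

end Model

end SecondOrder

/-! ### Operators of a functorial model and reconstruction of the functor from its clone. -/

namespace SecondOrder

namespace Model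

variable {E : Presentation.{u}} {C : Type w} [Category.{v} C] [HasFiniteProducts C]
  (F : Classifying E ⥤ C) [PreservesFiniteProducts F] {Y : C}

/-- The operator morphisms of a functorial model. -/
noncomputable def genericOp (ω : E.sig.Op) (n : ℕ) :
    (∏ᶜ fun i : Fin (E.sig.arity ω).len =>
      F.obj (Classifying.single E (n + (E.sig.arity ω).entry i))) ⟶
      F.obj (Classifying.single E n) :=
  op F ω (fun i => Pi.π _ i)

theorem comp_genericOp (ω : E.sig.Op) (n : ℕ)
    (a : Y ⟶ ∏ᶜ fun i : Fin (E.sig.arity ω).len =>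
      F.obj (Classifying.single E (n + (E.sig.arity ω).entry i))) :
    a ≫ genericOp F ω n = op F ω (fun i => a ≫ Pi.π _ i) :=
  comp_op F a ω _

/-- The clone underlying a functorial model. -/
noncomputable def clone : SigClone E.sig C where
  toClone := baseClone F
  opMap := genericOp F
  opMap_natural ω m n f := by
    -- Renaming is substitution of variables, so naturality is a special case of `op_sub`.
    refine (comp_genericOp F ω n _).trans ?_
    refine Eq.trans ?_ (comp_act F _ f).symm
    refine Eq.trans ?_ (op_sub F ω _ _).symm
    refine congrArg (op F ω) (funext fun i => ?_)
    refine (Pi.map_π _ i).trans ?_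
    refine (comp_act F _ _).trans ?_
    refine congrArg (sub F _) (funext fun x => ?_)
    induction x using Fin.addCases with
    | left x => rw [up_castAdd, Fin.append_left, var_sub]
    | right x => rw [up_natAdd, Fin.append_right]
  opMap_ς ω n m := by
    refine (map_genericSub F _ _).trans ?_
    refine Eq.trans ?_ (comp_genericOp F ω m _).symm
    refine (congrArg (fun k => sub F k _) (comp_genericOp F ω n _)).trans ?_
    refine (op_sub F ω _ _).trans ?_
    refine congrArg (op F ω) (funext fun i => ?_)
    refine Eq.trans ?_ ((Pi.lift_π (f := fun i : Fin (E.sig.arity ω).len =>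
      F.obj (Classifying.single E (m + (E.sig.arity ω).entry i))) _ i).trans
        (map_genericSub F _ _)).symm
    refine congrArg (sub F _) (funext fun x => ?_)
    refine Eq.trans ?_ (congrArg (prod.snd ≫ ·) (υ_π F m n _ x)).symm
    induction x using Fin.addCases with
    | left x =>
      rw [Fin.append_left, Fin.append_left]
      refine Eq.trans ?_ (comp_sub F _ _ _).symm
      refine congrArg₂ (sub F) (congrArg (prod.snd ≫ ·) (Category.id_comp _)) ?_
      exact funext fun y => (comp_var F _ _).symm
    | right x =>
      rw [Fin.append_right, Fin.append_right]
      exact (comp_var F _ _).symm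

/-- The clone operations are values of generic terms, and `value` is compatible with every term
former. -/
theorem interp_clone {Θ : NatSeq}
    (ρ : ∀ i : Fin Θ.len, Y ⟶ F.obj (Classifying.single E (Θ.entry i))) {n : ℕ}
    (t : Term E.sig Θ n) : ((clone F).elements Y).interp ρ t = value F ρ t := by
  induction t with
  | var x =>
    rw [value_var]
    exact comp_var F _ x
  | mvar i ts ih =>
    -- An applied metavariable is a substitution into the generic term, which reduces this case to
    -- `value_subst`.
    have h : Term.mvar i ts = (Term.generic (S := E.sig) i).subst ts := rfl
    rw [h, value_subst, value_generic]
    refine (lift_genericSub F _ _).trans (congrArg (sub F _) (funext fun j => ?_))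
    exact (Pi.lift_π _ j).trans (ih j)
  | op ω ts ih =>
    rw [value_op]
    refine (comp_genericOp F ω _ _).trans (congrArg (op F ω) (funext fun j => ?_))
    exact (Pi.lift_π _ j).trans (ih j)

theorem satisfiesAxioms_clone : satisfiesAxioms E C (clone F) := by
  intro e he d
  -- Extension is an instance of the metasubstitution rule, so the extended axiom is derivable and
  -- `F`, acting on classes, identifies its two sides.
  have h : Derivable E (e.lhs.extend d) (e.rhs.extend d) :=
    (Derivable.ax e he).extMsub (fun _ => Derivable.refl _)
  have key : ∀ t : Term E.sig (e.mctx.shift d) (e.ctx + d),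
      (clone F).interp t = value F (fun i => Pi.π _ i) t := fun t => by
    refine Eq.trans ?_ (((clone F).lift_interp _ t).trans (interp_clone F _ t))
    refine ((Category.id_comp _).symm.trans ?_)
    exact congrArg (· ≫ (clone F).interp t) (SigClone.piLift_π _ _).symm
  rw [key, key, value_eq_of_derivable F _ h]

/-- The clone underlying a functorial model, as a clone satisfying the axioms. -/
noncomputable def eclone : EClone E C := ⟨clone F, satisfiesAxioms_clone F⟩

/-- A functorial model is determined by its clone. -/
noncomputable def modelIso : (eclone F).model ≅ F :=
  NatIso.ofComponents (fun X =>
    { hom := tuple F X ((eclone F).modelProj X)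
      inv := (eclone F).modelLift X (fun i => F.map (X.proj i))
      hom_inv_id := by
        refine (eclone F).model_hom_ext (fun i => ?_)
        refine (Category.assoc _ _ _).trans ?_
        refine (congrArg (_ ≫ ·) (EClone.modelLift_proj _ _ i)).trans ?_
        exact (tuple_proj F X _ i).trans (Category.id_comp _).symm
      inv_hom_id := by
        refine obj_hom_ext F (fun i => ?_)
        refine (Category.assoc _ _ _).trans ?_
        refine (congrArg (_ ≫ ·) (tuple_proj F X _ i)).trans ?_
        exact (EClone.modelLift_proj _ _ i).trans (Category.id_comp _).symm })
    (fun {X Y} f => by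
      obtain ⟨a, rfl⟩ := exists_rep f
      refine obj_hom_ext F (fun i => ?_)
      -- After projection, both sides of the naturality square become the value of the
      -- representative `a i` at the projections; `interp_clone` matches them.
      have hr : (tuple F X ((eclone F).modelProj X) ≫ F.map (fun p => cls E (a p) : X ⟶ Y)) ≫
          F.map (Y.proj i) = value F ((eclone F).modelProj X) (a i) := by
        refine (Category.assoc _ _ _).trans (congrArg (_ ≫ ·) ?_)
        rw [← F.map_comp, Classifying.comp_proj]
      refine ((Category.assoc _ _ _).trans ?_).trans hr.symm
      refine (congrArg (_ ≫ ·) (tuple_proj F Y _ i)).trans ?_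
      refine (EClone.model_map_proj _ _ i).trans ?_
      refine Eq.trans ?_ (interp_clone F ((eclone F).modelProj X) (a i))
      refine Eq.trans ?_ ((eclone F).modelLift_interp _ (a i))
      refine (Category.id_comp _).symm.trans (congrArg (· ≫ _) ?_)
      refine (eclone F).model_hom_ext (fun j => ?_)
      rw [Category.id_comp]
      exact (EClone.modelLift_proj _ _ j).symm)

end Model

instance (E : Presentation.{u}) (C : Type w) [Category.{v} C] [HasFiniteProducts C] :
    (modelFunctor E C).EssSurj where
  mem_essImage F := by
    have : PreservesFiniteProducts F.obj := F.property
    exact ⟨Model.eclone F.obj, ⟨ObjectProperty.isoMk _ (Model.modelIso F.obj)⟩⟩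

instance (E : Presentation.{u}) (C : Type w) [Category.{v} C] [HasFiniteProducts C] :
    (modelFunctor E C).IsEquivalence where

end SecondOrder

theorem proposition7p5 (E : SecondOrder.Presentation.{u}) (C : Type w) [Category.{v} C]
    [HasFiniteProducts C] :
    Nonempty (SecondOrder.EClone E C ≌ SecondOrder.FMod (SecondOrder.theoryOf E) C) :=
  ⟨(SecondOrder.modelFunctor E C).asEquivalence⟩
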